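/- For a Borel measure $\mu$ on $\mathbb{C}$ put $U^{\mu}(z)=\int\log\frac{1}{|z-t|}\,d\mu(t)$ and $I(\mu)=\iint\log\frac{1}{|z-t|}\,d\mu(z)\,d\mu(t)$. A set $E\subset\mathbb{C}$ is polar if $I(\mu)=+\infty$ for every probability measure $\mu$ carried by a compact subset of $E$, and a property holds for q.e. (quasi-every) $z\in S$ if it holds on $S$ outside a Borel polar set. Let $K\subset\mathbb{C}$ be closed and nonpolar, and let $Q:K\to(-\infty,+\infty]$ be a weakly admissible weight on $K$, i.e. $Q$ is lower semicontinuous, $\{z\in K:Q(z)<\infty\}$ is nonpolar, $K$ is unbounded, and $\liminf_{z\in K,\,|z|\to\infty}(Q(z)-\log|z|)$ is a (finite) real number. Put $w=e^{-Q}$ and, for a probability measure $\mu$ on $K$, let $$I^{Q}(\mu)=\int_K\int_K\log\frac{1}{|z-t|\,w(z)\,w(t)}\,d\mu(z)\,d\mu(t).$$ Let $V_w=\inf_\mu I^{Q}(\mu)$, the infimum being over all probability measures $\mu$ on $K$, let $\mu_{K,Q}$ be the probability measure on $K$ with $I^{Q}(\mu_{K,Q})=V_w$ (the weighted equilibrium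 measure), $S_w=\operatorname{supp}\mu_{K,Q}$ and $F_w=V_w-\int_K Q\,d\mu_{K,Q}$. Let $k\ge 0$ be an integer, $p_k$ a complex polynomial of degree at most $k$, and $M\ge 0$ a real number such that $$|p_k(z)|\,e^{-kQ(z)}\le M\quad\text{for q.e. }z\in S_w,$$ where $e^{-kQ}$ means $w^k$ (so it equals $1$ if $k=0$). Then $$|p_k(z)|\le M\exp\bigl(k(-U^{\mu_{K,Q}}(z)+F_w)\bigr)\quad\text{for all }z\in\mathbb{C},$$ and $$|p_k(z)|\,e^{-kQ(z)}\le M\quad\text{for q.e. }z\in K.$$ -/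

import Mathlib

open MeasureTheory Filter Topology
open scoped ENNReal NNReal

namespace LogPotential

noncomputable section

/-- The integral of an extended-real function: the integral of the positive part minus the
integral of the negative part (the usual value whenever one of the two is finite). -/
def eintegral {X : Type*} [MeasurableSpace X] (μ : Measure X) (f : X → EReal) : EReal :=
  ((∫⁻ x, (f x).toENNReal ∂μ : ℝ≥0∞) : EReal) - ((∫⁻ x, (-f x).toENNReal ∂μ : ℝ≥0∞) : EReal)

/-- The logarithmic potential `U^μ(z) = ∫ log (1 / |z - t|) dμ(t)`, where `log (1 / 0) = +∞`. -/
def potential (μ : Measure ℂ) (z : ℂ) : EReal :=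
  eintegral μ (fun t => ENNReal.log (‖z - t‖ₑ)⁻¹)

/-- The logarithmic energy `I(μ) = ∬ log (1 / |z - t|) dμ(z) dμ(t)`. -/
def energy (μ : Measure ℂ) : EReal :=
  eintegral (μ.prod μ) (fun x => ENNReal.log (‖x.1 - x.2‖ₑ)⁻¹)

/-- The Borel probability measures on `ℂ` that are carried by `K`. -/
def probOn (K : Set ℂ) : Set (Measure ℂ) :=
  {μ | IsProbabilityMeasure μ ∧ μ Kᶜ = 0}

/-- A set is polar if every probability measure carried by a compact subset of it has infinite
logarithmic energy. -/
def IsPolar (E : Set ℂ) : Prop :=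
  ∀ C : Set ℂ, IsCompact C → C ⊆ E → ∀ μ ∈ probOn C, energy μ = ⊤

/-- `P z` holds for quasi-every `z ∈ S`: it holds on `S` outside a Borel polar set. -/
def QuasiEverywhereOn (S : Set ℂ) (P : ℂ → Prop) : Prop :=
  ∃ N : Set ℂ, MeasurableSet N ∧ IsPolar N ∧ ∀ z ∈ S \ N, P z

/-- `Q : K → (-∞, +∞]` is a weakly admissible weight on `K` (the values of `Q` outside `K` play
no role): it is lower semicontinuous, finite on a nonpolar set, and the lower limit of
`Q z - log |z|` as `|z| → ∞` within `K` is a real number. The last condition forces `K` to be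
unbounded, since the lower limit along the trivial filter is `⊤`. -/
structure WeaklyAdmissible (K : Set ℂ) (Q : ℂ → EReal) : Prop where
  ne_bot : ∀ z ∈ K, Q z ≠ ⊥
  lowerSemicontinuousOn : LowerSemicontinuousOn Q K
  nonpolar : ¬ IsPolar {z ∈ K | Q z < ⊤}
  liminf_eq : ∃ m : ℝ,
    liminf (fun z => Q z - ((Real.log ‖z‖ : ℝ) : EReal)) (Bornology.cobounded ℂ ⊓ 𝓟 K) = (m : EReal)

/-- The weight `w = e^{-Q}`, with `w = 0` where `Q = +∞`. -/
def weight (Q : ℂ → EReal) (z : ℂ) : ℝ≥0∞ := EReal.exp (-Q z)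

/-- The weighted energy `I^Q(μ) = ∬ log (1 / (|z - t| w(z) w(t))) dμ(z) dμ(t)`. -/
def weightedEnergy (Q : ℂ → EReal) (μ : Measure ℂ) : EReal :=
  eintegral (μ.prod μ) (fun x => ENNReal.log (‖x.1 - x.2‖ₑ * weight Q x.1 * weight Q x.2)⁻¹)

/-- `V_w`, the infimum of the weighted energy over the probability measures on `K`. -/
def minEnergy (K : Set ℂ) (Q : ℂ → EReal) : EReal :=
  ⨅ μ ∈ probOn K, weightedEnergy Q μ

/-- `μ` is a probability measure on `K` of minimal weighted energy. -/
def IsEquilibrium (K : Set ℂ) (Q : ℂ → EReal) (μ : Measure ℂ) : Prop :=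
  μ ∈ probOn K ∧ weightedEnergy Q μ = minEnergy K Q

open Classical in
/-- The weighted equilibrium measure `μ_{K,Q}`: the probability measure on `K` that minimizes the
weighted energy (`0` if there were none). -/
def equilibriumMeasure (K : Set ℂ) (Q : ℂ → EReal) : Measure ℂ :=
  if h : ∃ μ, IsEquilibrium K Q μ then h.choose else 0

/-- `S_w`, the support of the weighted equilibrium measure. -/
def equilibriumSupport (K : Set ℂ) (Q : ℂ → EReal) : Set ℂ :=
  (equilibriumMeasure K Q).support

/-- The modified Robin constant `F_w = V_w - ∫ Q dμ_{K,Q}`. -/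
def robinConst (K : Set ℂ) (Q : ℂ → EReal) : EReal :=
  minEnergy K Q - eintegral (equilibriumMeasure K Q) Q

end

end LogPotential

namespace LogPotential

noncomputable section

/-! The problem is moved to the Riemann sphere. There the kernel, minus the logarithm of the chordal
distance, is nonnegative, so potentials and energies live in [0, ∞] and Fatou and monotonicity apply
freely. Weak admissibility gives a constant C with q = Q - ½ log(1 + |z|²) + C ≥ 0 on K. With q = +∞
off K, the weighted energy of a probability measure on K is its spherical energy in the field q,
minus 2C (`weightedEnergy_eq`).

Measures of bounded spherical energy are tight, so a minimiser μ exists (`exists_fieldEnergy_le`).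
Let G be its spherical potential and F = ∫ (G + q) dμ. Perturbing μ yields Frostman's inequalities:
G + q ≥ F quasi-everywhere and G + q ≤ F on the support. Hence G is bounded on the support, which
forces a finite logarithmic moment, and then -U^μ + F_w = ½ log(1 + |z|²) - G + F - C wherever G is
finite.

On the support the upper inequality turns the hypothesis into |p| exp(k(G - ½ log(1 + |z|²))) ≤ M
exp(k(F - C)) off a polar set, hence μ-almost everywhere. A domination principle
(`norm_eval_mul_exp_le_of_ae`) spreads this bound over the plane, which is the first claim; on K the
lower inequality converts it into the second. Domination is obtained from compact pieces of μ with
continuous potential (`exists_isCompact_continuous_sphPotential`), a slight increase of mass that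
makes the weighted polynomial vanish at infinity, and the maximum modulus principle
(`norm_eval_mul_exp_le`). -/

theorem eintegral_eq_of_sub {X : Type*} [MeasurableSpace X] {μ : Measure X} {f : X → EReal}
    {a b : X → ℝ≥0∞} (ha : AEMeasurable a μ) (hb : AEMeasurable b μ)
    (hfin : ∫⁻ x, b x ∂μ ≠ ⊤) (hf : ∀ᵐ x ∂μ, f x = (a x : EReal) - (b x : EReal)) :
    eintegral μ f = ((∫⁻ x, a x ∂μ : ℝ≥0∞) : EReal) - ((∫⁻ x, b x ∂μ : ℝ≥0∞) : EReal) := by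
  have hbfin : ∀ᵐ x ∂μ, b x < ⊤ := ae_lt_top' hb hfin
  have hpos : ∀ᵐ x ∂μ, (f x).toENNReal = a x - b x := by
    filter_upwards [hf] with x hx
    rw [hx, EReal.toENNReal_sub (EReal.coe_ennreal_nonneg _)]
    simp
  have hneg : ∀ᵐ x ∂μ, (-f x).toENNReal = b x - a x := by
    filter_upwards [hf, hbfin] with x hx hx'
    rw [hx, EReal.neg_sub, add_comm, ← sub_eq_add_neg,
      EReal.toENNReal_sub (EReal.coe_ennreal_nonneg _)]
    · simp
    · left; simp
    · right; simpa using hx'.ne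
  -- Subtraction is truncated, so both integrands equal max(a, b). Finiteness of ∫ b then permits
  -- the rearrangement into a difference.
  have key : ∫⁻ x, (a x - b x) ∂μ + ∫⁻ x, b x ∂μ = ∫⁻ x, a x ∂μ + ∫⁻ x, (b x - a x) ∂μ := by
    rw [← lintegral_add_right' _ hb, ← lintegral_add_left' ha]
    refine lintegral_congr_ae ?_
    filter_upwards with x
    rw [tsub_add_eq_max, add_tsub_eq_max]
  have hle : ∫⁻ x, (b x - a x) ∂μ ≠ ⊤ :=
    ne_top_of_le_ne_top hfin (lintegral_mono fun x => tsub_le_self)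
  rw [eintegral, lintegral_congr_ae hpos, lintegral_congr_ae hneg]
  generalize ∫⁻ x, (a x - b x) ∂μ = A at *
  generalize ∫⁻ x, b x ∂μ = B at *
  generalize ∫⁻ x, a x ∂μ = A' at *
  generalize ∫⁻ x, (b x - a x) ∂μ = B' at *
  lift B to ℝ≥0 using hfin
  lift B' to ℝ≥0 using hle
  induction A with
  | top =>
    have : A' = ⊤ := by
      by_contra h
      lift A' to ℝ≥0 using h
      simp [← ENNReal.coe_add] at key
    subst this
    simp only [EReal.coe_ennreal_top]
    rw [← ENNReal.ofReal_coe_nnreal, ← ENNReal.ofReal_coe_nnreal]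
    simp
  | coe A =>
    induction A' with
    | top => simp [← ENNReal.coe_add] at key
    | coe A' =>
      norm_cast at key
      have h := congrArg (fun x : ℝ≥0 => (x : ℝ)) key
      simp only [NNReal.coe_add] at h
      change (((A : ℝ) : EReal) - ((B' : ℝ) : EReal)) = ((A' : ℝ) : EReal) - ((B : ℝ) : EReal)
      rw [← EReal.coe_sub, ← EReal.coe_sub]
      congr 1
      linarith

/-! ### Chordal metric and logarithmic kernel of the sphere -/

/-- The stretching factor `√(1 + |z|²)` of the stereographic projection. -/
def stretch (z : ℂ) : ℝ := √(1 + ‖z‖ ^ 2)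

theorem one_le_stretch (z : ℂ) : 1 ≤ stretch z :=
  Real.one_le_sqrt.2 (by nlinarith [sq_nonneg ‖z‖])

theorem stretch_pos (z : ℂ) : 0 < stretch z := lt_of_lt_of_le one_pos (one_le_stretch z)

theorem stretch_sq (z : ℂ) : stretch z ^ 2 = 1 + ‖z‖ ^ 2 :=
  Real.sq_sqrt (by positivity)

theorem norm_le_stretch (z : ℂ) : ‖z‖ ≤ stretch z := by
  refine Real.le_sqrt_of_sq_le (by linarith)

@[fun_prop]
theorem continuous_stretch : Continuous stretch := by
  unfold stretch; fun_prop

/-- The logarithm of the stretching factor, `½ log (1 + |z|²)`. -/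
def logStretch (z : ℂ) : ℝ := Real.log (stretch z)

theorem logStretch_nonneg (z : ℂ) : 0 ≤ logStretch z := Real.log_nonneg (one_le_stretch z)

theorem exp_logStretch (z : ℂ) : Real.exp (logStretch z) = stretch z :=
  Real.exp_log (stretch_pos z)

@[fun_prop]
theorem continuous_logStretch : Continuous logStretch :=
  continuous_stretch.log fun z => (stretch_pos z).ne'

/-- The chordal distance of the Riemann sphere, up to a factor `2`. -/
def chord (z t : ℂ) : ℝ := ‖z - t‖ / (stretch z * stretch t)

theorem chord_nonneg (z t : ℂ) : 0 ≤ chord z t :=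
  div_nonneg (norm_nonneg _) (mul_pos (stretch_pos z) (stretch_pos t)).le

theorem chord_comm (z t : ℂ) : chord z t = chord t z := by
  rw [chord, chord, norm_sub_rev, mul_comm]

theorem chord_self (z : ℂ) : chord z z = 0 := by simp [chord]

theorem chord_pos {z t : ℂ} (h : z ≠ t) : 0 < chord z t :=
  div_pos (norm_pos_iff.2 (sub_ne_zero.2 h)) (mul_pos (stretch_pos z) (stretch_pos t))

/-- Cauchy–Schwarz in ℝ², the source of both the bound `chord ≤ 1` and the triangle inequality. -/
theorem mul_add_mul_le_sqrt_mul_sqrt (a b c d : ℝ) :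
    a * c + b * d ≤ √(a ^ 2 + b ^ 2) * √(c ^ 2 + d ^ 2) := by
  rw [← Real.sqrt_mul (by positivity)]
  exact Real.le_sqrt_of_sq_le (by nlinarith [sq_nonneg (a * d - b * c)])

theorem norm_add_norm_le_stretch_mul (z t : ℂ) : ‖z‖ + ‖t‖ ≤ stretch z * stretch t := by
  have := mul_add_mul_le_sqrt_mul_sqrt ‖z‖ 1 1 ‖t‖
  simpa [stretch, add_comm] using this

theorem norm_one_add_conj_mul_le (y t : ℂ) :
    ‖1 + starRingEnd ℂ y * t‖ ≤ stretch y * stretch t := by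
  refine (norm_add_le _ _).trans ?_
  have := mul_add_mul_le_sqrt_mul_sqrt 1 ‖y‖ 1 ‖t‖
  simpa [stretch] using this

theorem chord_le_one (z t : ℂ) : chord z t ≤ 1 := by
  rw [chord, div_le_one (mul_pos (stretch_pos z) (stretch_pos t))]
  exact (norm_sub_le _ _).trans (norm_add_norm_le_stretch_mul z t)

theorem chord_triangle (z y t : ℂ) : chord z t ≤ chord z y + chord y t := by
  have hz := stretch_pos z
  have hy := stretch_pos y
  have ht := stretch_pos t
  -- This identity replaces the embedding into ℝ³: after taking norms, |1 + ȳt| is at most the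
  -- product of the stretching factors of y and t, and likewise for z.
  have hid : (z - t) * ((stretch y ^ 2 : ℝ) : ℂ) =
      (z - y) * (1 + starRingEnd ℂ y * t) + (y - t) * (1 + starRingEnd ℂ y * z) := by
    rw [stretch_sq]
    have : ((1 + ‖y‖ ^ 2 : ℝ) : ℂ) = 1 + starRingEnd ℂ y * y := by
      rw [Complex.conj_mul']; push_cast; ring
    rw [this]; ring
  have hn : ‖z - t‖ * stretch y ^ 2 ≤
      ‖z - y‖ * (stretch y * stretch t) + ‖y - t‖ * (stretch y * stretch z) := by
    calc ‖z - t‖ * stretch y ^ 2 = ‖(z - t) * ((stretch y ^ 2 : ℝ) : ℂ)‖ := by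
          rw [norm_mul, Complex.norm_real, Real.norm_of_nonneg (by positivity)]
      _ ≤ _ := by
          rw [hid]
          refine (norm_add_le _ _).trans ?_
          rw [norm_mul, norm_mul]
          gcongr
          · exact norm_one_add_conj_mul_le y t
          · exact norm_one_add_conj_mul_le y z
  rw [chord, chord, chord, div_add_div _ _ (by positivity) (by positivity),
    div_le_div_iff₀ (by positivity) (by positivity)]
  nlinarith [mul_le_mul_of_nonneg_left hn (mul_pos hz ht).le]

@[fun_prop]
theorem continuous_chord : Continuous fun x : ℂ × ℂ => chord x.1 x.2 := by
  unfold chord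
  refine Continuous.div (by fun_prop) (by fun_prop) fun x => ?_
  exact (mul_pos (stretch_pos _) (stretch_pos _)).ne'

/-- The logarithmic kernel `log (1 / chord z t)` of the Riemann sphere. -/
def kernel (z t : ℂ) : ℝ≥0∞ := (ENNReal.log (ENNReal.ofReal (chord z t))⁻¹).toENNReal

theorem kernel_comm (z t : ℂ) : kernel z t = kernel t z := by rw [kernel, kernel, chord_comm]

theorem kernel_self (z : ℂ) : kernel z z = ⊤ := by simp [kernel, chord_self]

theorem kernel_of_ne {z t : ℂ} (h : z ≠ t) : kernel z t = ENNReal.ofReal (-Real.log (chord z t)) := by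
  rw [kernel, ← ENNReal.ofReal_inv_of_pos (chord_pos h),
    ENNReal.log_ofReal_of_pos (inv_pos.2 (chord_pos h)), Real.log_inv]
  rfl

theorem log_chord {z t : ℂ} (h : z ≠ t) :
    Real.log (chord z t) = Real.log ‖z - t‖ - logStretch z - logStretch t := by
  rw [chord, Real.log_div (norm_ne_zero_iff.2 (sub_ne_zero.2 h))
    (mul_pos (stretch_pos z) (stretch_pos t)).ne',
    Real.log_mul (stretch_pos z).ne' (stretch_pos t).ne', logStretch, logStretch]
  ring

theorem log_chord_nonpos (z t : ℂ) : Real.log (chord z t) ≤ 0 :=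
  Real.log_nonpos (chord_nonneg z t) (chord_le_one z t)

theorem continuous_kernel : Continuous fun x : ℂ × ℂ => kernel x.1 x.2 := by
  unfold kernel
  refine EReal.continuous_toENNReal.comp (ENNReal.continuous_log.comp ?_)
  exact continuous_inv.comp (ENNReal.continuous_ofReal.comp continuous_chord)

theorem measurable_kernel : Measurable fun x : ℂ × ℂ => kernel x.1 x.2 :=
  continuous_kernel.measurable

theorem measurable_kernel_comp {X : Type*} [MeasurableSpace X] {f g : X → ℂ} (hf : Measurable f)
    (hg : Measurable g) : Measurable fun x => kernel (f x) (g x) :=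
  Measurable.comp (g := fun x : ℂ × ℂ => kernel x.1 x.2) (f := fun x => (f x, g x))
    measurable_kernel (Measurable.prodMk hf hg)

theorem kernel_toReal {z t : ℂ} (h : z ≠ t) :
    (kernel z t).toReal = logStretch z + logStretch t - Real.log ‖z - t‖ := by
  rw [kernel_of_ne h, ENNReal.toReal_ofReal (by linarith [log_chord_nonpos z t]), log_chord h]
  ring

/-- The kernel of the plane is the kernel of the sphere up to the logarithms of the stretching
factors. -/
theorem log_inv_enorm_sub (z t : ℂ) :
    ENNReal.log (‖z - t‖ₑ)⁻¹ = (kernel z t : EReal) -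
      ((ENNReal.ofReal (logStretch z) + ENNReal.ofReal (logStretch t) : ℝ≥0∞) : EReal) := by
  rw [← ENNReal.ofReal_add (logStretch_nonneg z) (logStretch_nonneg t), EReal.coe_ennreal_ofReal,
    max_eq_left (add_nonneg (logStretch_nonneg z) (logStretch_nonneg t))]
  by_cases h : z = t
  · rw [h, kernel_self, sub_self, enorm_zero, ENNReal.inv_zero, ENNReal.log_top,
      EReal.coe_ennreal_top, EReal.top_sub_coe]
  · have h0 : 0 < ‖z - t‖ := norm_pos_iff.2 (sub_ne_zero.2 h)
    rw [kernel_of_ne h, EReal.coe_ennreal_ofReal,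
      max_eq_left (by linarith [log_chord_nonpos z t]), log_chord h, ← EReal.coe_sub,
      ← ofReal_norm, ← ENNReal.ofReal_inv_of_pos h0,
      ENNReal.log_ofReal_of_pos (inv_pos.2 h0), Real.log_inv]
    congr 1
    ring

/-! ### Spherical potentials and energies -/

/-- The potential of `μ` with respect to the kernel of the sphere. -/
def sphPotential (μ : Measure ℂ) (z : ℂ) : ℝ≥0∞ := ∫⁻ t, kernel z t ∂μ

/-- The mutual energy of `μ` and `ν` with respect to the kernel of the sphere. -/
def sphEnergy (μ ν : Measure ℂ) : ℝ≥0∞ := ∫⁻ z, sphPotential ν z ∂μ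

theorem measurable_kernel_right (z : ℂ) : Measurable (kernel z) :=
  measurable_kernel_comp measurable_const measurable_id

theorem measurable_sphPotential (μ : Measure ℂ) [SFinite μ] : Measurable (sphPotential μ) :=
  measurable_kernel.lintegral_prod_right'

theorem continuous_kernel_left (t : ℂ) : Continuous fun z => kernel z t :=
  Continuous.comp (g := fun x : ℂ × ℂ => kernel x.1 x.2) (f := fun z => (z, t))
    continuous_kernel (by fun_prop)

/-- Fatou's lemma, available because the kernel is nonnegative and continuous with values in [0, ∞].
-/
theorem lowerSemicontinuous_sphPotential (μ : Measure ℂ) :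
    LowerSemicontinuous (sphPotential μ) := by
  intro z
  refine lowerSemicontinuousAt_iff_le_liminf.2 ?_
  calc sphPotential μ z = ∫⁻ t, liminf (fun y => kernel y t) (𝓝 z) ∂μ :=
        lintegral_congr fun t => ((continuous_kernel_left t).tendsto z).liminf_eq.symm
    _ ≤ liminf (fun y => ∫⁻ t, kernel y t ∂μ) (𝓝 z) :=
        lintegral_liminf_le (f := fun y t => kernel y t) measurable_kernel_right

theorem sphPotential_add (μ ν : Measure ℂ) (z : ℂ) :
    sphPotential (μ + ν) z = sphPotential μ z + sphPotential ν z :=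
  lintegral_add_measure _ _ _

theorem sphPotential_smul (c : ℝ≥0∞) (μ : Measure ℂ) (z : ℂ) :
    sphPotential (c • μ) z = c * sphPotential μ z :=
  lintegral_smul_measure _ _

theorem sphPotential_mono {μ ν : Measure ℂ} (h : μ ≤ ν) (z : ℂ) :
    sphPotential μ z ≤ sphPotential ν z :=
  lintegral_mono' h le_rfl

theorem sphEnergy_eq_prod (μ ν : Measure ℂ) [SFinite ν] :
    sphEnergy μ ν = ∫⁻ x, kernel x.1 x.2 ∂(μ.prod ν) :=
  (lintegral_prod _ measurable_kernel.aemeasurable).symm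

theorem sphEnergy_comm (μ ν : Measure ℂ) [SFinite μ] [SFinite ν] :
    sphEnergy μ ν = sphEnergy ν μ := by
  rw [sphEnergy, sphEnergy]
  simp only [sphPotential]
  rw [lintegral_lintegral_swap measurable_kernel.aemeasurable]
  simp only [kernel_comm]

theorem sphEnergy_smul_smul (a b : ℝ≥0∞) (μ ν : Measure ℂ) [SFinite ν] :
    sphEnergy (a • μ) (b • ν) = a * (b * sphEnergy μ ν) := by
  rw [sphEnergy, lintegral_smul_measure, smul_eq_mul, sphEnergy]
  simp only [sphPotential_smul]
  rw [lintegral_const_mul _ (measurable_sphPotential ν)]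

theorem sphEnergy_mono {μ ν : Measure ℂ} (h : μ ≤ ν) : sphEnergy μ μ ≤ sphEnergy ν ν :=
  lintegral_mono' h fun z => sphPotential_mono h z

theorem sphEnergy_add_right (μ ν₁ ν₂ : Measure ℂ) [SFinite ν₁] :
    sphEnergy μ (ν₁ + ν₂) = sphEnergy μ ν₁ + sphEnergy μ ν₂ := by
  rw [sphEnergy]
  simp only [sphPotential_add]
  rw [lintegral_add_left (measurable_sphPotential ν₁), sphEnergy, sphEnergy]

theorem sphEnergy_add_left (μ₁ μ₂ ν : Measure ℂ) :
    sphEnergy (μ₁ + μ₂) ν = sphEnergy μ₁ ν + sphEnergy μ₂ ν :=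
  lintegral_add_measure _ _ _

/-! ### Polar sets and measures of finite energy -/

/-- For measures carried by a compact set, infinite energy in the plane is infinite energy on the
sphere. -/
theorem energy_eq_top_iff {C : Set ℂ} (hC : IsCompact C) {ν : Measure ℂ} (hν : ν ∈ probOn C) :
    energy ν = ⊤ ↔ sphEnergy ν ν = ⊤ := by
  obtain ⟨hprob, hνC⟩ := hν
  obtain ⟨B, hB⟩ := hC.exists_bound_of_continuousOn continuous_logStretch.continuousOn
  have hae : ∀ᵐ z ∂ν, z ∈ C := by rw [ae_iff]; exact hνC
  have hL : ∫⁻ z, ENNReal.ofReal (logStretch z) ∂ν ≤ ENNReal.ofReal B := by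
    calc ∫⁻ z, ENNReal.ofReal (logStretch z) ∂ν ≤ ∫⁻ _, ENNReal.ofReal B ∂ν := by
          refine lintegral_mono_ae ?_
          filter_upwards [hae] with z hz
          exact ENNReal.ofReal_le_ofReal ((le_abs_self _).trans (hB z hz))
      _ = ENNReal.ofReal B := by simp
  have hm : Measurable fun z => ENNReal.ofReal (logStretch z) := by fun_prop
  have hfin : ∫⁻ x, (ENNReal.ofReal (logStretch x.1) + ENNReal.ofReal (logStretch x.2))
      ∂(ν.prod ν) ≠ ⊤ := by
    have hm1 : Measurable fun x : ℂ × ℂ => ENNReal.ofReal (logStretch x.1) :=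
      hm.comp measurable_fst
    rw [lintegral_add_left hm1,
      measurePreserving_fst.lintegral_comp hm, measurePreserving_snd.lintegral_comp hm]
    exact (ENNReal.add_lt_top.2 ⟨hL.trans_lt (by simp), hL.trans_lt (by simp)⟩).ne
  rw [energy, eintegral_eq_of_sub (a := fun x : ℂ × ℂ => kernel x.1 x.2)
    measurable_kernel.aemeasurable
    ((hm.comp measurable_fst).add (hm.comp measurable_snd)).aemeasurable hfin
    (Eventually.of_forall fun x => log_inv_enorm_sub x.1 x.2), ← sphEnergy_eq_prod]
  simp only [Pi.add_apply, Function.comp_apply]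
  generalize (∫⁻ x, (ENNReal.ofReal (logStretch x.1) + ENNReal.ofReal (logStretch x.2))
      ∂(ν.prod ν)) = b at *
  lift b to ℝ≥0 using hfin
  generalize sphEnergy ν ν = a
  induction a with
  | top => simp
  | coe a =>
    simp only [ENNReal.coe_ne_top, iff_false]
    exact EReal.coe_ne_top ((a : ℝ) - (b : ℝ))

/-- The restriction of `ν` to `A`, normalised. -/
def condOn (ν : Measure ℂ) (A : Set ℂ) : Measure ℂ := (ν A)⁻¹ • ν.restrict A

theorem condOn_mem_probOn {ν : Measure ℂ} [IsFiniteMeasure ν] {A : Set ℂ} (hA : MeasurableSet A)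
    (h0 : ν A ≠ 0) : condOn ν A ∈ probOn A := by
  refine ⟨⟨?_⟩, ?_⟩
  · simp [condOn, ENNReal.inv_mul_cancel h0 (measure_ne_top ν A)]
  · simp [condOn, Measure.restrict_apply hA.compl]

theorem sphEnergy_condOn_ne_top {ν : Measure ℂ} [IsFiniteMeasure ν] {A : Set ℂ} (h0 : ν A ≠ 0)
    (h : sphEnergy ν ν ≠ ⊤) : sphEnergy (condOn ν A) (condOn ν A) ≠ ⊤ := by
  rw [condOn, sphEnergy_smul_smul]
  have h1 : (ν A)⁻¹ ≠ ⊤ := ENNReal.inv_ne_top.2 h0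
  exact ENNReal.mul_ne_top h1 (ENNReal.mul_ne_top h1
    (ne_top_of_le_ne_top h (sphEnergy_mono Measure.restrict_le_self)))

/-- Measures of finite energy do not charge Borel polar sets. -/
theorem IsPolar.measure_eq_zero {N : Set ℂ} (hN : IsPolar N) (hNm : MeasurableSet N)
    {μ : Measure ℂ} [IsFiniteMeasure μ] (hμ : sphEnergy μ μ ≠ ⊤) : μ N = 0 := by
  by_contra h
  -- If N were charged, inner regularity would give a compact part of positive mass; normalising μ
  -- there keeps the energy finite, against polarity.
  obtain ⟨C, hCN, hC, hpos⟩ := hNm.exists_lt_isCompact (μ := μ) (pos_iff_ne_zero.2 h)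
  have hmem := condOn_mem_probOn hC.measurableSet hpos.ne'
  exact sphEnergy_condOn_ne_top hpos.ne' hμ
    ((energy_eq_top_iff hC hmem).1 (hN C hC hCN _ hmem))

/-! ### Existence of a minimiser in an external field -/

/-- The integral of a lower semicontinuous function is lower semicontinuous under weak
convergence. -/
theorem lintegral_le_liminf_of_lowerSemicontinuous {Ω : Type*} [MeasurableSpace Ω]
    [TopologicalSpace Ω] [OpensMeasurableSpace Ω] [HasOuterApproxClosed Ω]
    {μ : ProbabilityMeasure Ω} {μs : ℕ → ProbabilityMeasure Ω} (hμ : Tendsto μs atTop (𝓝 μ))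
    {f : Ω → ℝ≥0∞} (hf : LowerSemicontinuous f) :
    ∫⁻ x, f x ∂(μ : Measure Ω) ≤ liminf (fun n => ∫⁻ x, f x ∂(μs n : Measure Ω)) atTop := by
  have hfm : Measurable f := hf.measurable
  -- Truncation makes the layer-cake formula applicable. It reduces the claim to the portmanteau
  -- inequality on the open superlevel sets, followed by Fatou in the level t.
  let g : ℕ → Ω → ℝ := fun m x => (min (f x) m).toReal
  have hgm : ∀ m, Measurable (g m) := fun m => (hfm.min measurable_const).ennreal_toReal
  have hfin : ∀ (m : ℕ) x, min (f x) (m : ℝ≥0∞) ≠ ⊤ := fun m x =>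
    ne_top_of_le_ne_top (ENNReal.natCast_ne_top m) (min_le_right _ _)
  have hg : ∀ m x, ENNReal.ofReal (g m x) = min (f x) m := fun m x =>
    ENNReal.ofReal_toReal (hfin m x)
  have hlt : ∀ m (t : ℝ), 0 ≤ t → IsOpen {x | t < g m x} := by
    intro m t ht
    have : {x | t < g m x} = {x | ENNReal.ofReal t < f x} ∩ {_x | ENNReal.ofReal t < (m : ℝ≥0∞)} := by
      ext x
      simp only [Set.mem_ofPred_eq, Set.mem_inter_iff, ← lt_min_iff, g]
      rw [ENNReal.ofReal_lt_iff_lt_toReal ht (hfin m x)]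
    rw [this]
    exact (hf.isOpen_preimage _).inter isOpen_const
  have hstep : ∀ m : ℕ, ∫⁻ x, min (f x) m ∂(μ : Measure Ω) ≤
      liminf (fun n => ∫⁻ x, f x ∂(μs n : Measure Ω)) atTop := by
    intro m
    have hlc : ∀ ν : Measure Ω, ∫⁻ x, min (f x) m ∂ν = ∫⁻ t in Set.Ioi (0 : ℝ), ν {x | t < g m x} := by
      intro ν
      rw [← lintegral_eq_lintegral_meas_lt ν (Eventually.of_forall fun x => ENNReal.toReal_nonneg)
        (hgm m).aemeasurable]
      exact lintegral_congr fun x => (hg m x).symm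
    calc ∫⁻ x, min (f x) m ∂(μ : Measure Ω)
        = ∫⁻ t in Set.Ioi (0 : ℝ), (μ : Measure Ω) {x | t < g m x} := hlc _
      _ ≤ ∫⁻ t in Set.Ioi (0 : ℝ), liminf (fun n => (μs n : Measure Ω) {x | t < g m x}) atTop :=
          setLIntegral_mono' measurableSet_Ioi fun t ht =>
            ProbabilityMeasure.le_liminf_measure_open_of_tendsto hμ (hlt m t (le_of_lt ht))
      _ ≤ liminf (fun n => ∫⁻ t in Set.Ioi (0 : ℝ), (μs n : Measure Ω) {x | t < g m x}) atTop :=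
          lintegral_liminf_le fun n => Antitone.measurable fun s t hst =>
            measure_mono fun x hx => lt_of_le_of_lt hst hx
      _ = liminf (fun n => ∫⁻ x, min (f x) m ∂(μs n : Measure Ω)) atTop := by simp only [hlc]
      _ ≤ _ := liminf_le_liminf (Eventually.of_forall fun n =>
          lintegral_mono fun x => min_le_left _ _)
  have hsup : ∀ x, f x = ⨆ m : ℕ, min (f x) m := by
    intro x
    rw [← inf_iSup_eq, ENNReal.iSup_natCast, inf_top_eq]
  calc ∫⁻ x, f x ∂(μ : Measure Ω) = ⨆ m : ℕ, ∫⁻ x, min (f x) m ∂(μ : Measure Ω) := by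
        rw [← lintegral_iSup (fun m => hfm.min measurable_const)
          (fun m n hmn x => min_le_min le_rfl (by exact_mod_cast hmn))]
        exact lintegral_congr hsup
    _ ≤ _ := iSup_le hstep

/-- The energy on the sphere in the external field `q`. -/
def fieldEnergy (q : ℂ → ℝ≥0∞) (μ : Measure ℂ) : ℝ≥0∞ := sphEnergy μ μ + 2 * ∫⁻ z, q z ∂μ

theorem fieldEnergy_eq_prod {q : ℂ → ℝ≥0∞} {μ : Measure ℂ} [IsProbabilityMeasure μ]
    (hq : AEMeasurable q μ) :
    fieldEnergy q μ = ∫⁻ x, (kernel x.1 x.2 + (q x.1 + q x.2)) ∂(μ.prod μ) := by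
  have h1 : AEMeasurable (fun x : ℂ × ℂ => q x.1) (μ.prod μ) :=
    hq.comp_quasiMeasurePreserving Measure.quasiMeasurePreserving_fst
  have h2 : AEMeasurable (fun x : ℂ × ℂ => q x.2) (μ.prod μ) :=
    hq.comp_quasiMeasurePreserving Measure.quasiMeasurePreserving_snd
  have e1 : ∫⁻ x, q x.1 ∂(μ.prod μ) = ∫⁻ z, q z ∂μ := by
    rw [lintegral_prod _ h1]; simp
  have e2 : ∫⁻ x, q x.2 ∂(μ.prod μ) = ∫⁻ z, q z ∂μ := by
    rw [lintegral_prod _ h2]; simp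
  rw [lintegral_add_left measurable_kernel, lintegral_add_left' h1, e1, e2, fieldEnergy,
    sphEnergy_eq_prod, two_mul]

/-- For |z|, |t| ≥ R one has 1 / chord ≥ |z||t| / (|z| + |t|) ≥ R/2: points far out are close to
each other on the sphere. -/
theorem log_half_le_kernel {R : ℝ} (hR : 0 < R) {z t : ℂ} (hz : R ≤ ‖z‖) (ht : R ≤ ‖t‖) :
    ENNReal.ofReal (Real.log (R / 2)) ≤ kernel z t := by
  by_cases h : z = t
  · simp [h, kernel_self]
  rw [kernel_of_ne h]
  refine ENNReal.ofReal_le_ofReal ?_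
  rw [← Real.log_inv]
  refine Real.log_le_log (by positivity) ?_
  rw [chord, inv_div, div_le_div_iff₀ two_pos (norm_pos_iff.2 (sub_ne_zero.2 h))]
  have h1 : ‖z - t‖ ≤ ‖z‖ + ‖t‖ := norm_sub_le _ _
  have h2 : ‖z‖ * ‖t‖ ≤ stretch z * stretch t :=
    mul_le_mul (norm_le_stretch z) (norm_le_stretch t) (norm_nonneg _) (stretch_pos z).le
  nlinarith [mul_le_mul_of_nonneg_left h1 hR.le]

/-- Mass above ε outside the ball of radius 2eᶜ interacts with itself through a kernel at least c,
so it costs energy at least cε²; c is chosen with cε² > B. -/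
theorem isTightMeasureSet_sphEnergy_le {B : ℝ≥0∞} (hB : B ≠ ⊤) :
    IsTightMeasureSet {μ : Measure ℂ | sphEnergy μ μ ≤ B} := by
  rw [isTightMeasureSet_iff_exists_isCompact_measure_compl_le]
  intro ε hε
  by_cases hεt : ε = ⊤
  · exact ⟨∅, isCompact_empty, fun μ _ => by simp [hεt]⟩
  have hε2 : ε * ε ≠ 0 := mul_ne_zero hε.ne' hε.ne'
  obtain ⟨c, hc⟩ := exists_gt (B / (ε * ε)).toReal
  have hc' : B < ENNReal.ofReal c * (ε * ε) := by
    rw [← ENNReal.div_lt_iff (Or.inl hε2) (Or.inl (ENNReal.mul_ne_top hεt hεt))]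
    exact (ENNReal.lt_ofReal_iff_toReal_lt (ENNReal.div_ne_top hB hε2)).2 hc
  refine ⟨Metric.closedBall 0 (2 * Real.exp c), isCompact_closedBall _ _, fun μ hμ => ?_⟩
  by_contra! hlt
  set A := (Metric.closedBall (0 : ℂ) (2 * Real.exp c))ᶜ with hA
  have hAm : MeasurableSet A := Metric.isClosed_closedBall.measurableSet.compl
  have hR : ∀ z ∈ A, 2 * Real.exp c ≤ ‖z‖ := fun z hz => by
    simp only [hA, Set.mem_compl_iff, mem_closedBall_zero_iff, not_le] at hz
    exact hz.le
  have hk : ∀ z ∈ A, ∀ t ∈ A, ENNReal.ofReal c ≤ kernel z t := fun z hz t ht => by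
    have := log_half_le_kernel (by positivity) (hR z hz) (hR t ht)
    rwa [mul_div_cancel_left₀ _ two_ne_zero, Real.log_exp] at this
  have : ENNReal.ofReal c * (μ A * μ A) ≤ sphEnergy μ μ := by
    calc ENNReal.ofReal c * (μ A * μ A) = ∫⁻ _ in A, ∫⁻ _ in A, ENNReal.ofReal c ∂μ ∂μ := by
          simp only [setLIntegral_const]; ring
      _ ≤ ∫⁻ z in A, ∫⁻ t in A, kernel z t ∂μ ∂μ :=
          setLIntegral_mono' hAm fun z hz => setLIntegral_mono' hAm fun t ht => hk z hz t ht
      _ ≤ sphEnergy μ μ := lintegral_mono' Measure.restrict_le_self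
          fun z => lintegral_mono' Measure.restrict_le_self le_rfl
  have h2 : ENNReal.ofReal c * (ε * ε) ≤ ENNReal.ofReal c * (μ A * μ A) := by gcongr
  exact absurd (h2.trans (this.trans hμ)) (not_le.2 hc')

/-- The direct method: a minimising sequence has bounded spherical energy because q ≥ 0, Prokhorov
gives a weak limit, and lower semicontinuity of the kernel plus field on ℂ × ℂ passes to it. The
field need not confine mass. -/
theorem exists_fieldEnergy_le {q : ℂ → ℝ≥0∞} (hq : LowerSemicontinuous q)
    (hfin : ∃ ν : Measure ℂ, IsProbabilityMeasure ν ∧ fieldEnergy q ν ≠ ⊤) :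
    ∃ μ : Measure ℂ, IsProbabilityMeasure μ ∧
      ∀ ν : Measure ℂ, IsProbabilityMeasure ν → fieldEnergy q μ ≤ fieldEnergy q ν := by
  set I : ℝ≥0∞ := ⨅ ν : ProbabilityMeasure ℂ, fieldEnergy q ν with hI
  have hIle : ∀ ν : Measure ℂ, IsProbabilityMeasure ν → I ≤ fieldEnergy q ν := fun ν hν =>
    iInf_le (fun ν : ProbabilityMeasure ℂ => fieldEnergy q ν) ⟨ν, hν⟩
  have hIfin : I ≠ ⊤ := by
    obtain ⟨ν, hν, h⟩ := hfin
    exact ne_top_of_le_ne_top h (hIle ν hν)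
  have hex : ∀ n : ℕ, ∃ ν : ProbabilityMeasure ℂ, fieldEnergy q ν < I + ((n : ℝ≥0∞) + 1)⁻¹ := by
    intro n
    exact iInf_lt_iff.1 (ENNReal.lt_add_right hIfin (by simp))
  choose ν hν using hex
  set S : Set (ProbabilityMeasure ℂ) := {μ | sphEnergy μ μ ≤ I + 1}
  have hcomp : IsCompact (closure S) := by
    refine isCompact_closure_of_isTightMeasureSet
      ((isTightMeasureSet_sphEnergy_le (B := I + 1) (by simp [hIfin])).subset ?_)
    rintro _ ⟨μ, hμ, rfl⟩
    exact hμ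
  have hmem : ∀ n, ν n ∈ closure S := fun n => subset_closure <| by
    refine (le_self_add.trans (hν n).le).trans ?_
    gcongr
    simp
  obtain ⟨μ, -, φ, hφ, hlim⟩ := hcomp.isSeqCompact hmem
  refine ⟨μ, inferInstance, fun ρ hρ => le_trans ?_ (hIle ρ hρ)⟩
  have hlim2 : Tendsto (fun n => (ν (φ n)).prod (ν (φ n))) atTop (𝓝 (μ.prod μ)) :=
    (ProbabilityMeasure.continuous_prod.tendsto (μ, μ)).comp (hlim.prodMk_nhds hlim)
  have hlsc : LowerSemicontinuous fun x : ℂ × ℂ => kernel x.1 x.2 + (q x.1 + q x.2) :=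
    continuous_kernel.lowerSemicontinuous.add
      ((hq.comp continuous_fst).add (hq.comp continuous_snd))
  have hqm : ∀ ρ : Measure ℂ, AEMeasurable q ρ := fun ρ => hq.measurable.aemeasurable
  have key := lintegral_le_liminf_of_lowerSemicontinuous hlim2 hlsc
  simp only [ProbabilityMeasure.toMeasure_prod] at key
  rw [← fieldEnergy_eq_prod (hqm _)] at key
  refine key.trans ?_
  have hseq : Tendsto (fun n => I + ((φ n : ℝ≥0∞) + 1)⁻¹) atTop (𝓝 I) := by
    have h1 : Tendsto (fun n : ℕ => I + ((n : ℝ≥0∞) + 1)⁻¹) atTop (𝓝 (I + 0)) := by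
      refine tendsto_const_nhds.add ?_
      have := (tendsto_add_atTop_iff_nat 1).2 ENNReal.tendsto_inv_nat_nhds_zero
      simpa using this
    rw [add_zero] at h1
    exact h1.comp hφ.tendsto_atTop
  calc _ ≤ liminf (fun n => I + ((φ n : ℝ≥0∞) + 1)⁻¹) atTop := by
        refine liminf_le_liminf (Eventually.of_forall fun n => ?_)
        rw [← fieldEnergy_eq_prod (hqm _)]
        exact (hν (φ n)).le
    _ = I := hseq.liminf_eq

/-! ### Frostman's inequalities -/

section Frostman

variable {q : ℂ → ℝ≥0∞} {μ : Measure ℂ}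

theorem lintegral_sphPotential_add (hq : Measurable q) :
    ∫⁻ z, (sphPotential μ z + q z) ∂μ = sphEnergy μ μ + ∫⁻ z, q z ∂μ :=
  lintegral_add_right _ hq

/-- A probability measure ν of finite energy on a compact part of this set would have ∫ (G + q) dν <
F. Moving from μ towards ν would then lower the energy to first order. -/
theorem isPolar_setOf_sphPotential_add_lt [IsProbabilityMeasure μ] (hq : Measurable q)
    (hfin : fieldEnergy q μ ≠ ⊤)
    (hmin : ∀ ν : Measure ℂ, IsProbabilityMeasure ν → fieldEnergy q μ ≤ fieldEnergy q ν) :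
    IsPolar {z | sphPotential μ z + q z < ∫⁻ z, (sphPotential μ z + q z) ∂μ} := by
  intro C hC hCN ν hν
  rw [energy_eq_top_iff hC hν]
  by_contra hνfin
  obtain ⟨hνp, hνC⟩ := hν
  set F := ∫⁻ z, (sphPotential μ z + q z) ∂μ with hF
  have hA : sphEnergy μ μ ≠ ⊤ := ne_top_of_le_ne_top hfin le_self_add
  have hX : ∫⁻ z, q z ∂μ ≠ ⊤ := by
    intro h
    simp [fieldEnergy, h] at hfin
  have hFeq : F = sphEnergy μ μ + ∫⁻ z, q z ∂μ := lintegral_sphPotential_add hq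
  have hFfin : F ≠ ⊤ := by rw [hFeq]; exact ENNReal.add_ne_top.2 ⟨hA, hX⟩
  have hae : ∀ᵐ z ∂ν, sphPotential μ z + q z < F := by
    have : ∀ᵐ z ∂ν, z ∈ C := by rw [ae_iff]; exact hνC
    filter_upwards [this] with z hz using hCN hz
  have hint : sphEnergy ν μ + ∫⁻ z, q z ∂ν < F := by
    have h1 : ∫⁻ z, (sphPotential μ z + q z) ∂ν = sphEnergy ν μ + ∫⁻ z, q z ∂ν :=
      lintegral_add_right _ hq
    have h2 : ∫⁻ z, (sphPotential μ z + q z) ∂ν ≠ ⊤ := by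
      refine ne_top_of_le_ne_top hFfin ?_
      calc _ ≤ ∫⁻ _, F ∂ν := lintegral_mono_ae (hae.mono fun z hz => hz.le)
        _ = F := by simp
    have := lintegral_strict_mono (NeZero.ne ν) aemeasurable_const h2 hae
    rw [h1] at this
    simpa using this
  have hBY := ne_top_of_lt hint
  have hBfin : sphEnergy ν μ ≠ ⊤ := ne_top_of_le_ne_top hBY le_self_add
  have hYfin : ∫⁻ z, q z ∂ν ≠ ⊤ := ne_top_of_le_ne_top hBY le_add_self
  have hcomm : sphEnergy μ ν = sphEnergy ν μ := sphEnergy_comm μ ν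
  have hquad : ∀ s : ℝ, 0 < s → s < 1 →
      (sphEnergy μ μ).toReal + 2 * (∫⁻ z, q z ∂μ).toReal ≤
      (1 - s) * ((1 - s) * (sphEnergy μ μ).toReal + s * (sphEnergy ν μ).toReal) +
      s * ((1 - s) * (sphEnergy ν μ).toReal + s * (sphEnergy ν ν).toReal) +
      2 * ((1 - s) * (∫⁻ z, q z ∂μ).toReal + s * (∫⁻ z, q z ∂ν).toReal) := by
    intro s hs0 hs1
    have hs1' : 0 < 1 - s := by linarith
    set ρ : Measure ℂ := ENNReal.ofReal (1 - s) • μ + ENNReal.ofReal s • ν with hρ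
    have hρp : IsProbabilityMeasure ρ := ⟨by
      simp [hρ, ← ENNReal.ofReal_add hs1'.le hs0.le]⟩
    have hE : sphEnergy ρ ρ = ENNReal.ofReal (1 - s) * (ENNReal.ofReal (1 - s) * sphEnergy μ μ +
        ENNReal.ofReal s * sphEnergy ν μ) + ENNReal.ofReal s * (ENNReal.ofReal (1 - s) *
        sphEnergy ν μ + ENNReal.ofReal s * sphEnergy ν ν) := by
      rw [hρ, sphEnergy_add_left, sphEnergy_add_right, sphEnergy_add_right]
      simp only [sphEnergy_smul_smul, hcomm]
      ring
    have hQ : ∫⁻ z, q z ∂ρ = ENNReal.ofReal (1 - s) * ∫⁻ z, q z ∂μ +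
        ENNReal.ofReal s * ∫⁻ z, q z ∂ν := by
      rw [hρ, lintegral_add_measure, lintegral_smul_measure, lintegral_smul_measure]
      rfl
    have h := hmin ρ hρp
    rw [fieldEnergy, fieldEnergy, hE, hQ] at h
    lift sphEnergy μ μ to ℝ≥0 using hA with a
    lift sphEnergy ν μ to ℝ≥0 using hBfin with b
    lift sphEnergy ν ν to ℝ≥0 using hνfin with c
    lift ∫⁻ z, q z ∂μ to ℝ≥0 using hX with x
    lift ∫⁻ z, q z ∂ν to ℝ≥0 using hYfin with y
    lift s to ℝ≥0 using hs0.le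
    obtain ⟨r, hr⟩ : ∃ r : ℝ≥0, (r : ℝ) = 1 - s := ⟨⟨1 - s, hs1'.le⟩, rfl⟩
    rw [← hr] at h ⊢
    simp only [ENNReal.ofReal_coe_nnreal] at h
    norm_cast at h
  set a := (sphEnergy μ μ).toReal
  set b := (sphEnergy ν μ).toReal
  set c := (sphEnergy ν ν).toReal
  set x := (∫⁻ z, q z ∂μ).toReal
  set y := (∫⁻ z, q z ∂ν).toReal
  have hlt : b + y < a + x := by
    rw [hFeq] at hint
    have := (ENNReal.toReal_lt_toReal hBY (ENNReal.add_ne_top.2 ⟨hA, hX⟩)).2 hint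
    rwa [ENNReal.toReal_add hBfin hYfin, ENNReal.toReal_add hA hX] at this
  have hd : 0 < a + x - b - y := by linarith
  -- With d = a + x - b - y, the energy change is -2sd + s²(a - 2b + c). Taking s = d/e gives s < 1
  -- and s|a - 2b + c| ≤ se = d < 2d, so the change is negative.
  set e := |a - 2 * b + c| + 1 + (a + x - b - y) with he
  have hepos : 0 < e := by positivity
  have hs := hquad ((a + x - b - y) / e) (div_pos hd hepos) (by
    rw [div_lt_one hepos, he]; linarith [abs_nonneg (a - 2 * b + c)])
  set s := (a + x - b - y) / e with hs_def
  have hspos : 0 < s := div_pos hd hepos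
  have hse : s * e = a + x - b - y := div_mul_cancel₀ _ hepos.ne'
  have h1 : 0 ≤ s * (s * (a - 2 * b + c) - 2 * (a + x - b - y)) := by nlinarith
  have h2 : 0 ≤ s * (a - 2 * b + c) - 2 * (a + x - b - y) := nonneg_of_mul_nonneg_right h1 hspos
  nlinarith [le_abs_self (a - 2 * b + c)]

/-- The lower inequality holds μ-almost everywhere, since finite energy ignores polar sets. As F is
the mean of G + q, equality holds almost everywhere, so {G + q > F} is null. It is open by
semicontinuity and hence misses the support. -/
theorem sphPotential_add_le_of_mem_support [IsProbabilityMeasure μ] (hq : LowerSemicontinuous q)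
    (hfin : fieldEnergy q μ ≠ ⊤)
    (hmin : ∀ ν : Measure ℂ, IsProbabilityMeasure ν → fieldEnergy q μ ≤ fieldEnergy q ν)
    {z₀ : ℂ} (hz : z₀ ∈ μ.support) :
    sphPotential μ z₀ + q z₀ ≤ ∫⁻ z, (sphPotential μ z + q z) ∂μ := by
  by_contra! hlt
  set F := ∫⁻ z, (sphPotential μ z + q z) ∂μ with hF
  have hA : sphEnergy μ μ ≠ ⊤ := ne_top_of_le_ne_top hfin le_self_add
  have hm : Measurable fun z => sphPotential μ z + q z :=
    (measurable_sphPotential μ).add hq.measurable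
  have hFfin : F ≠ ⊤ := ne_top_of_lt hlt
  have hnull : μ {z | sphPotential μ z + q z < F} = 0 :=
    (isPolar_setOf_sphPotential_add_lt hq.measurable hfin hmin).measure_eq_zero
      (measurableSet_lt hm measurable_const) hA
  have hge : ∀ᵐ z ∂μ, F ≤ sphPotential μ z + q z := by
    rw [ae_iff]; simpa using hnull
  have hlsc : LowerSemicontinuous fun z => sphPotential μ z + q z :=
    (lowerSemicontinuous_sphPotential μ).add hq
  have hpos : 0 < μ {z | F < sphPotential μ z + q z} :=
    (Measure.mem_support_iff_forall z₀).1 hz _ ((hlsc.isOpen_preimage F).mem_nhds hlt)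
  have heq : (fun _ => F) =ᵐ[μ] fun z => sphPotential μ z + q z := by
    refine ae_eq_of_ae_le_of_lintegral_le hge (by simpa using hFfin) hm.aemeasurable ?_
    simp [hF]
  have : μ {z | F < sphPotential μ z + q z} = 0 := by
    have h0 : ∀ᵐ z ∂μ, ¬ F < sphPotential μ z + q z := by
      filter_upwards [heq] with z hz using by rw [← hz]; exact lt_irrefl _
    rw [ae_iff] at h0
    simpa using h0
  exact hpos.ne' this

end Frostman

/-! ### Finite logarithmic moment -/

/-- A probability measure whose spherical potential is bounded on its support has a finite
logarithmic moment. -/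
theorem lintegral_logStretch_ne_top {F : ℝ≥0∞} (hF : F ≠ ⊤)
    {μ : Measure ℂ} [IsProbabilityMeasure μ]
    (h : ∀ z ∈ μ.support, sphPotential μ z ≤ F) :
    ∫⁻ z, ENNReal.ofReal (logStretch z) ∂μ ≠ ⊤ := by
  have hm : Measurable fun z => ENNReal.ofReal (logStretch z) := by fun_prop
  by_cases hb : Bornology.IsBounded μ.support
  · have hC := Metric.isCompact_of_isClosed_isBounded Measure.isClosed_support hb
    obtain ⟨B, hB⟩ := hC.exists_bound_of_continuousOn continuous_logStretch.continuousOn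
    refine ne_top_of_le_ne_top (ENNReal.ofReal_ne_top (r := B)) ?_
    calc ∫⁻ z, ENNReal.ofReal (logStretch z) ∂μ ≤ ∫⁻ _, ENNReal.ofReal B ∂μ := by
          refine lintegral_mono_ae ?_
          filter_upwards [Measure.support_mem_ae] with z hz
          exact ENNReal.ofReal_le_ofReal ((le_abs_self _).trans (hB z hz))
      _ = ENNReal.ofReal B := by simp
  -- As z → ∞ the kernel tends to `logStretch t`. For |t| ≤ n < |z| the bound |z - t| ≤ 2|z| gives
  -- this up to log 2, so support points escaping to infinity transfer the bound F to the moment.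
  · have hunb : ∀ n : ℕ, ∃ z ∈ μ.support, (n : ℝ) < ‖z‖ := by
      by_contra! hcon
      obtain ⟨n, hn⟩ := hcon
      exact hb ((Metric.isBounded_closedBall (x := (0 : ℂ)) (r := n)).subset fun z hz => by
        simpa using hn z hz)
    have hpt : ∀ n : ℕ, ∫⁻ t in Metric.closedBall 0 (n : ℝ), ENNReal.ofReal (logStretch t) ∂μ ≤
        F + ENNReal.ofReal (Real.log 2) := by
      intro n
      obtain ⟨z, hz, hzn⟩ := hunb n
      have hzpos : 0 < ‖z‖ := lt_of_le_of_lt (Nat.cast_nonneg n) hzn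
      have hk : ∀ t ∈ Metric.closedBall (0 : ℂ) n,
          ENNReal.ofReal (logStretch t) ≤ kernel z t + ENNReal.ofReal (Real.log 2) := by
        intro t ht
        rw [mem_closedBall_zero_iff] at ht
        have hne : z ≠ t := by rintro rfl; linarith
        have h0 : 0 < ‖z - t‖ := norm_pos_iff.2 (sub_ne_zero.2 hne)
        rw [kernel_of_ne hne, ← ENNReal.ofReal_add (by linarith [log_chord_nonpos z t])
          (Real.log_nonneg (by norm_num)), log_chord hne]
        refine ENNReal.ofReal_le_ofReal ?_
        have h1 : Real.log ‖z - t‖ ≤ Real.log 2 + logStretch z := by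
          rw [logStretch, ← Real.log_mul two_ne_zero (stretch_pos z).ne']
          refine Real.log_le_log h0 ?_
          linarith [norm_sub_le z t, norm_le_stretch z]
        linarith
      calc ∫⁻ t in Metric.closedBall 0 (n : ℝ), ENNReal.ofReal (logStretch t) ∂μ
          ≤ ∫⁻ t in Metric.closedBall 0 (n : ℝ),
              (kernel z t + ENNReal.ofReal (Real.log 2)) ∂μ :=
            setLIntegral_mono' Metric.isClosed_closedBall.measurableSet hk
        _ ≤ ∫⁻ t, (kernel z t + ENNReal.ofReal (Real.log 2)) ∂μ :=
            setLIntegral_le_lintegral _ _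
        _ = sphPotential μ z + ENNReal.ofReal (Real.log 2) := by
            rw [lintegral_add_right _ measurable_const]; simp [sphPotential]
        _ ≤ _ := by gcongr; exact h z hz
    refine ne_top_of_le_ne_top (ENNReal.add_ne_top.2 ⟨hF, ENNReal.ofReal_ne_top⟩)
      (b := F + ENNReal.ofReal (Real.log 2)) ?_
    rw [← setLIntegral_univ, ← Metric.iUnion_closedBall_nat (0 : ℂ),
      setLIntegral_iUnion_of_directed _
        (Monotone.directed_le fun m n hmn => Metric.closedBall_subset_closedBall
          (by exact_mod_cast hmn))]
    exact iSup_le hpt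

/-! ### Restrictions with continuous potential -/

/-- Since log 2 < 1, replacing a point by a nearest point of a compact set costs only one unit of
truncation level. -/
theorem kernel_le_kernel_add_one {z z' t : ℂ} (h : chord z' t ≤ 2 * chord z t) :
    kernel z t ≤ kernel z' t + 1 := by
  by_cases hz' : z' = t
  · simp [hz', kernel_self]
  have hpos := chord_pos hz'
  have hz : z ≠ t := by
    rintro rfl
    rw [chord_self] at h
    linarith
  rw [kernel_of_ne hz, kernel_of_ne hz', ← ENNReal.ofReal_one,
    ← ENNReal.ofReal_add (by linarith [log_chord_nonpos z' t]) zero_le_one]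
  refine ENNReal.ofReal_le_ofReal ?_
  have h1 := Real.log_le_log hpos h
  rw [Real.log_mul two_ne_zero (chord_pos hz).ne'] at h1
  linarith [Real.log_two_lt_d9]

theorem continuous_truncated_potential (μ : Measure ℂ) [IsFiniteMeasure μ] (m : ℝ≥0) :
    Continuous fun z => (∫⁻ t, min (kernel z t) m ∂μ).toReal := by
  have hfin : ∀ z t, min (kernel z t) (m : ℝ≥0∞) ≠ ⊤ := fun z t =>
    ne_top_of_le_ne_top ENNReal.coe_ne_top (min_le_right _ _)
  have heq : (fun z => (∫⁻ t, min (kernel z t) m ∂μ).toReal) =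
      fun z => ∫ t, (min (kernel z t) (m : ℝ≥0∞)).toReal ∂μ := by
    funext z
    rw [integral_toReal ((measurable_kernel_right z).min measurable_const).aemeasurable
      (Eventually.of_forall fun t => (hfin z t).lt_top)]
  rw [heq]
  refine continuous_of_dominated (bound := fun _ => (m : ℝ)) (fun z => ?_) (fun z => ?_)
    (integrable_const _) ?_
  · exact ((measurable_kernel_right z).min
      measurable_const).ennreal_toReal.aestronglyMeasurable
  · refine Eventually.of_forall fun t => ?_
    rw [Real.norm_of_nonneg ENNReal.toReal_nonneg]
    exact ENNReal.toReal_mono ENNReal.coe_ne_top (min_le_right _ _)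
  · refine Eventually.of_forall fun t => ?_
    have hc : Continuous fun z => min (kernel z t) (m : ℝ≥0∞) :=
      (continuous_kernel_left t).min continuous_const
    exact continuous_iff_continuousAt.2 fun z =>
      (ENNReal.tendsto_toReal (hfin z t)).comp (hc.tendsto z)

theorem tendsto_lintegral_kernel_sub {μ : Measure ℂ} {z : ℂ} (h : sphPotential μ z ≠ ⊤) :
    Tendsto (fun n : ℕ => ∫⁻ t, (kernel z t - n) ∂μ) atTop (𝓝 0) := by
  have hm : ∀ n : ℕ, Measurable fun t => kernel z t - (n : ℝ≥0∞) := fun n =>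
    (measurable_kernel_right z).sub measurable_const
  have := tendsto_lintegral_of_dominated_convergence (μ := μ)
    (F := fun (n : ℕ) t => kernel z t - (n : ℝ≥0∞)) (f := fun _ => 0) (kernel z) hm
    (fun n => Eventually.of_forall fun t => tsub_le_self) h (by
      filter_upwards [ae_lt_top (measurable_kernel_right z) h] with t ht
      refine tendsto_const_nhds.congr' ?_
      obtain ⟨N, hN⟩ := ENNReal.exists_nat_gt ht.ne
      filter_upwards [eventually_ge_atTop N] with n hn
      exact (tsub_eq_zero_of_le (hN.le.trans (by exact_mod_cast hn))).symm)
  simpa using this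

/-- A measure of finite energy is, up to a small mass, carried by a compact set on which its
restriction has a bounded continuous potential. -/
theorem exists_isCompact_continuous_sphPotential {μ : Measure ℂ} [IsFiniteMeasure μ]
    (hμ : sphEnergy μ μ ≠ ⊤) {T : Set ℂ} (hT : ∀ᵐ z ∂μ, z ∈ T) {ε : ℝ} (hε : 0 < ε) :
    ∃ A ⊆ T, IsCompact A ∧ μ Aᶜ ≤ ENNReal.ofReal ε ∧
      (∀ z, sphPotential (μ.restrict A) z ≠ ⊤) ∧
      Continuous (fun z => (sphPotential (μ.restrict A) z).toReal) ∧
      ∃ B : ℝ, ∀ z, (sphPotential (μ.restrict A) z).toReal ≤ B := by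
  -- The tails tend to zero wherever the potential is finite. Egorov makes this uniform off a set of
  -- small measure, inside whose complement the compact set A is chosen.
  let tail : ℕ → ℂ → ℝ≥0∞ := fun n z => ∫⁻ t, (kernel z t - n) ∂μ
  have htm : ∀ n, Measurable (tail n) := fun n =>
    Measurable.lintegral_prod_right' (f := fun x : ℂ × ℂ => kernel x.1 x.2 - (n : ℝ≥0∞))
      (measurable_kernel.sub measurable_const)
  have hfinae : ∀ᵐ z ∂μ, sphPotential μ z < ⊤ := ae_lt_top (measurable_sphPotential μ) hμ
  obtain ⟨E, hE, hEμ, hunif⟩ := tendstoUniformlyOn_of_ae_tendsto' (μ := μ)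
    (f := fun n z => (tail n z).toReal) (g := fun _ => 0)
    (fun n => (htm n).ennreal_toReal.stronglyMeasurable) stronglyMeasurable_const (by
      filter_upwards [hfinae] with z hz
      have := (ENNReal.tendsto_toReal ENNReal.zero_ne_top).comp
        (tendsto_lintegral_kernel_sub hz.ne)
      rw [ENNReal.toReal_zero] at this
      exact this) (half_pos hε)
  obtain ⟨T', hT', hT'm, hT's⟩ := (hT.and hfinae).exists_measurable_mem
  have hDm : MeasurableSet (T' ∩ Eᶜ) := hT'm.inter hE.compl
  obtain ⟨A, hAD, hA, hAμ⟩ := hDm.exists_isCompact_sdiff_lt (μ := μ) (measure_ne_top _ _)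
    (ε := ENNReal.ofReal (ε / 2)) (by simpa using hε)
  refine ⟨A, fun z hz => (hT's z (hAD hz).1).1, hA, ?_, ?_⟩
  · calc μ Aᶜ ≤ μ (T'ᶜ ∪ (E ∪ (T' ∩ Eᶜ) \ A)) := by
          refine measure_mono fun z hz => ?_
          by_cases h1 : z ∈ T' <;> by_cases h2 : z ∈ E <;> simp_all
      _ ≤ μ T'ᶜ + (μ E + μ ((T' ∩ Eᶜ) \ A)) :=
          (measure_union_le _ _).trans (by gcongr; exact measure_union_le _ _)
      _ ≤ 0 + (ENNReal.ofReal (ε / 2) + ENNReal.ofReal (ε / 2)) := by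
          have : μ T'ᶜ = 0 := hT'
          gcongr
          exact this.le
      _ = ENNReal.ofReal ε := by
          rw [zero_add, ← ENNReal.ofReal_add (by positivity) (by positivity), add_halves]
  rcases A.eq_empty_or_nonempty with rfl | hne
  · simp only [Measure.restrict_empty]
    refine ⟨fun z => by simp [sphPotential], ?_, 0, fun z => by simp [sphPotential]⟩
    simpa [sphPotential] using continuous_const
  have htail_fin : ∀ n, ∀ z ∈ A, tail n z ≠ ⊤ := fun n z hz =>
    ne_top_of_le_ne_top (hT's z (hAD hz).1).2.ne (lintegral_mono fun t => tsub_le_self)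
  have htail : ∀ δ > 0, ∃ N : ℕ, ∀ n ≥ N, ∀ z ∈ A, tail n z < ENNReal.ofReal δ := by
    intro δ hδ
    obtain ⟨N, hN⟩ := eventually_atTop.1 (Metric.tendstoUniformlyOn_iff.1 hunif δ hδ)
    refine ⟨N, fun n hn z hz => ?_⟩
    have := hN n hn z (hAD hz).2
    rw [dist_zero_left, Real.norm_of_nonneg ENNReal.toReal_nonneg] at this
    rwa [ENNReal.lt_ofReal_iff_toReal_lt (htail_fin n z hz)]
  -- Uniformity on A becomes uniformity on ℂ: with z' a chordally nearest point of A, chord(z', t) ≤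
  -- 2 chord(z, t) for t in A.
  have hglob : ∀ z, ∃ z' ∈ A, ∀ n : ℕ,
      ∫⁻ t in A, (kernel z t - (n + 1 : ℕ)) ∂μ ≤ tail n z' := by
    intro z
    have hcz : Continuous fun t => chord z t :=
      Continuous.comp (g := fun x : ℂ × ℂ => chord x.1 x.2) (f := fun t => (z, t))
        continuous_chord (by fun_prop)
    obtain ⟨z', hz', hmin⟩ := hA.exists_isMinOn hne hcz.continuousOn
    refine ⟨z', hz', fun n => ?_⟩
    calc ∫⁻ t in A, (kernel z t - (n + 1 : ℕ)) ∂μ ≤ ∫⁻ t in A, (kernel z' t - n) ∂μ := by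
          refine setLIntegral_mono' hA.measurableSet fun t ht => ?_
          have h1 : chord z' t ≤ 2 * chord z t := by
            have := chord_triangle z' z t
            rw [chord_comm z' z] at this
            linarith [show chord z z' ≤ chord z t from hmin ht]
          have h2 := kernel_le_kernel_add_one h1
          rw [tsub_le_iff_right]
          refine h2.trans ?_
          push_cast
          rw [← add_assoc]
          gcongr
          exact le_tsub_add
      _ ≤ tail n z' := setLIntegral_le_lintegral _ _
  have hsplit : ∀ (n : ℕ) z, sphPotential (μ.restrict A) z =
      ∫⁻ t in A, min (kernel z t) ((n + 1 : ℕ) : ℝ≥0) ∂μ +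
        ∫⁻ t in A, (kernel z t - (n + 1 : ℕ)) ∂μ := by
    intro n z
    rw [← lintegral_add_left ((measurable_kernel_right z).min measurable_const), sphPotential]
    refine lintegral_congr fun t => ?_
    rw [add_comm]
    exact tsub_add_min.symm
  have hminle : ∀ (n : ℕ) z, ∫⁻ t in A, min (kernel z t) ((n + 1 : ℕ) : ℝ≥0) ∂μ ≤
      (n + 1 : ℕ) * μ A := by
    intro n z
    calc _ ≤ ∫⁻ _ in A, ((n + 1 : ℕ) : ℝ≥0∞) ∂μ := lintegral_mono fun t => min_le_right _ _
      _ = _ := setLIntegral_const _ _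
  have hcfin : ∀ n : ℕ, ((n + 1 : ℕ) : ℝ≥0∞) * μ A ≠ ⊤ := fun n =>
    ENNReal.mul_ne_top (ENNReal.natCast_ne_top _) (measure_ne_top _ _)
  have hbound : ∃ B : ℝ≥0∞, B ≠ ⊤ ∧ ∀ z, sphPotential (μ.restrict A) z ≤ B := by
    obtain ⟨N, hN⟩ := htail 1 one_pos
    refine ⟨_, ENNReal.add_ne_top.2 ⟨hcfin N, ENNReal.ofReal_ne_top (r := 1)⟩, fun z => ?_⟩
    obtain ⟨z', hz', h⟩ := hglob z
    rw [hsplit N z]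
    exact add_le_add (hminle N z) ((h N).trans (hN N le_rfl z' hz').le)
  obtain ⟨B, hB, hBle⟩ := hbound
  have hfin : ∀ z, sphPotential (μ.restrict A) z ≠ ⊤ := fun z => ne_top_of_le_ne_top hB (hBle z)
  refine ⟨hfin, ?_, B.toReal, fun z => ENNReal.toReal_mono hB (hBle z)⟩
  -- The truncated potentials are continuous and differ from the full one by the tails, so the limit
  -- is uniform and continuous.
  have hu : TendstoUniformly (fun (n : ℕ) z =>
      (∫⁻ t in A, min (kernel z t) ((n + 1 : ℕ) : ℝ≥0) ∂μ).toReal)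
      (fun z => (sphPotential (μ.restrict A) z).toReal) atTop := by
    rw [Metric.tendstoUniformly_iff]
    intro δ hδ
    obtain ⟨N, hN⟩ := htail δ hδ
    filter_upwards [eventually_ge_atTop N] with n hn z
    obtain ⟨z', hz', h⟩ := hglob z
    have hlt : ∫⁻ t in A, (kernel z t - (n + 1 : ℕ)) ∂μ < ENNReal.ofReal δ :=
      (h n).trans_lt (hN n hn z' hz')
    rw [hsplit n z, ENNReal.toReal_add (ne_top_of_le_ne_top (hcfin n) (hminle n z))
      (ne_top_of_lt hlt), Real.dist_eq, add_sub_cancel_left,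
      abs_of_nonneg ENNReal.toReal_nonneg]
    rwa [← ENNReal.lt_ofReal_iff_toReal_lt (ne_top_of_lt hlt)]
  exact hu.continuous (Frequently.of_forall fun n => continuous_truncated_potential _ _)

/-! ### Local holomorphic structure of potentials off a compact carrier -/

/-- The gap 2r, twice the radius of the ball, keeps 1 + (z - w)/(w - t) in the disc of radius ½
about 1, where the principal logarithm is holomorphic. -/
theorem norm_div_le_half {w t z : ℂ} {r : ℝ} (hr : 0 < r) (hw : 2 * r ≤ ‖w - t‖)
    (hz : z ∈ Metric.ball w r) : ‖(z - w) / (w - t)‖ ≤ 1 / 2 := by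
  rw [norm_div, div_le_div_iff₀ (by linarith) two_pos]
  rw [mem_ball_iff_norm] at hz
  linarith

theorem one_add_div_eq {w t z : ℂ} (hw : w - t ≠ 0) : 1 + (z - w) / (w - t) = (z - t) / (w - t) := by
  field_simp
  ring

theorem one_add_div_mem_slitPlane {w t z : ℂ} {r : ℝ} (hr : 0 < r) (hw : 2 * r ≤ ‖w - t‖)
    (hz : z ∈ Metric.ball w r) : 1 + (z - w) / (w - t) ∈ Complex.slitPlane :=
  Complex.mem_slitPlane_of_norm_lt_one ((norm_div_le_half hr hw hz).trans_lt (by norm_num))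

section Holomorphic

variable {σ : Measure ℂ} [IsFiniteMeasure σ] {A : Set ℂ} {w : ℂ} {r : ℝ}

theorem integrable_of_continuousOn {E : Type*} [NormedAddCommGroup E] (hA : IsCompact A)
    (hσ : σ Aᶜ = 0) {f : ℂ → E} (hf : ContinuousOn f A) : Integrable f σ := by
  have : σ.restrict A = σ := Measure.restrict_eq_self_of_ae_mem (by rw [ae_iff]; exact hσ)
  have h := hf.integrableOn_compact (μ := σ) hA
  rwa [IntegrableOn, this] at h

theorem integrable_log_one_add (hA : IsCompact A) (hσ : σ Aᶜ = 0) (hr : 0 < r)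
    (hw : ∀ t ∈ A, 2 * r ≤ ‖w - t‖) {z : ℂ} (hz : z ∈ Metric.ball w r) :
    Integrable (fun t => Complex.log (1 + (z - w) / (w - t))) σ := by
  refine integrable_of_continuousOn hA hσ (ContinuousOn.clog ?_ fun t ht =>
    one_add_div_mem_slitPlane hr (hw t ht) hz)
  refine continuousOn_const.add (continuousOn_const.div (by fun_prop) fun t ht => ?_)
  exact norm_pos_iff.1 (by linarith [hw t ht])

theorem differentiableOn_integral_log (hA : IsCompact A) (hσ : σ Aᶜ = 0) (hr : 0 < r)
    (hw : ∀ t ∈ A, 2 * r ≤ ‖w - t‖) :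
    DifferentiableOn ℂ (fun z => ∫ t, Complex.log (1 + (z - w) / (w - t)) ∂σ)
      (Metric.ball w r) := by
  intro z hz
  have hae : ∀ᵐ t ∂σ, t ∈ A := by rw [ae_iff]; exact hσ
  have hball : Metric.ball w r ∈ 𝓝 z := Metric.isOpen_ball.mem_nhds hz
  -- The bound 1/r is 1/(2r) for 1/|w - t| times 2 for the reciprocal of a number of modulus at
  -- least ½.
  refine ((hasDerivAt_integral_of_dominated_loc_of_deriv_le (μ := σ) (bound := fun _ => 1 / r)
    (F := fun z t => Complex.log (1 + (z - w) / (w - t)))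
    (F' := fun z t => (1 / (w - t)) / (1 + (z - w) / (w - t))) hball ?_ ?_ ?_ ?_
    (integrable_const _) ?_).2).differentiableAt.differentiableWithinAt
  · filter_upwards [hball] with y hy
    exact (integrable_log_one_add hA hσ hr hw hy).aestronglyMeasurable
  · exact integrable_log_one_add hA hσ hr hw hz
  · refine (integrable_of_continuousOn hA hσ ?_).aestronglyMeasurable
    have h0 : ∀ t ∈ A, w - t ≠ 0 := fun t ht => norm_pos_iff.1 (by linarith [hw t ht])
    refine ContinuousOn.div (continuousOn_const.div (by fun_prop) h0)
      (continuousOn_const.add (continuousOn_const.div (by fun_prop) h0)) fun t ht => ?_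
    exact Complex.slitPlane_ne_zero (one_add_div_mem_slitPlane hr (hw t ht) hz)
  · filter_upwards [hae] with t ht y hy
    have h1 := norm_div_le_half hr (hw t ht) hy
    have h2 : 1 / 2 ≤ ‖1 + (y - w) / (w - t)‖ := by
      have := norm_sub_le_norm_add (1 : ℂ) ((y - w) / (w - t))
      rw [norm_one] at this
      linarith
    rw [norm_div, norm_div, norm_one, div_le_div_iff₀ (by linarith) hr, one_mul]
    rw [one_div, inv_mul_le_iff₀ (by linarith [hw t ht])]
    nlinarith [hw t ht]
  · filter_upwards [hae] with t ht y hy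
    have h := (((hasDerivAt_id y).sub_const w).div_const (w - t)).const_add 1
    exact h.clog (one_add_div_mem_slitPlane hr (hw t ht) hy)

/-- Subtracting total mass times `logStretch z` removes the only part of the spherical potential
that is not harmonic in z off A. -/
theorem toReal_sphPotential_of_notMem (hA : IsCompact A) (hσ : σ Aᶜ = 0) {z : ℂ} (hz : z ∉ A) :
    (sphPotential σ z).toReal - (σ Set.univ).toReal * logStretch z =
      ∫ t, (logStretch t - Real.log ‖z - t‖) ∂σ := by
  have hae : ∀ᵐ t ∂σ, t ∈ A := by rw [ae_iff]; exact hσ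
  have hne : ∀ t ∈ A, z ≠ t := fun t ht h => hz (h ▸ ht)
  have hint : Integrable (fun t => logStretch t - Real.log ‖z - t‖) σ := by
    refine integrable_of_continuousOn hA hσ (continuous_logStretch.continuousOn.sub
      (ContinuousOn.log (by fun_prop) fun t ht => ?_))
    exact norm_ne_zero_iff.2 (sub_ne_zero.2 (hne t ht))
  rw [sphPotential, ← integral_toReal (measurable_kernel_right z).aemeasurable
    (hae.mono fun t ht => by rw [kernel_of_ne (hne t ht)]; exact ENNReal.ofReal_lt_top)]
  have : ∫ t, (kernel z t).toReal ∂σ =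
      ∫ t, (logStretch z + (logStretch t - Real.log ‖z - t‖)) ∂σ := by
    refine integral_congr_ae (hae.mono fun t ht => ?_)
    simp only [kernel_toReal (hne t ht)]
    ring
  rw [this, integral_add (integrable_const _) hint, integral_const, smul_eq_mul,
    Measure.real]
  ring

theorem toReal_sphPotential_eq_add_re (hA : IsCompact A) (hσ : σ Aᶜ = 0) (hr : 0 < r)
    (hw : ∀ t ∈ A, 2 * r ≤ ‖w - t‖) {z : ℂ} (hz : z ∈ Metric.ball w r) :
    (sphPotential σ z).toReal - (σ Set.univ).toReal * logStretch z =
      ((sphPotential σ w).toReal - (σ Set.univ).toReal * logStretch w) -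
        (∫ t, Complex.log (1 + (z - w) / (w - t)) ∂σ).re := by
  have hae : ∀ᵐ t ∂σ, t ∈ A := by rw [ae_iff]; exact hσ
  have h0 : ∀ t ∈ A, w - t ≠ 0 := fun t ht => norm_pos_iff.1 (by linarith [hw t ht])
  have hwA : w ∉ A := fun h => h0 w h (sub_self w)
  have hz0 : ∀ t ∈ A, z - t ≠ 0 := fun t ht h => by
    have h1 := Complex.slitPlane_ne_zero (one_add_div_mem_slitPlane hr (hw t ht) hz)
    rw [one_add_div_eq (h0 t ht), h, zero_div] at h1
    exact h1 rfl
  have hzA : z ∉ A := fun h => hz0 z h (sub_self z)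
  have hint : ∀ y, (∀ t ∈ A, y - t ≠ 0) →
      Integrable (fun t => logStretch t - Real.log ‖y - t‖) σ := fun y hy =>
    integrable_of_continuousOn hA hσ (continuous_logStretch.continuousOn.sub
      (ContinuousOn.log (by fun_prop) fun t ht => norm_ne_zero_iff.2 (hy t ht)))
  have hre : (∫ t, Complex.log (1 + (z - w) / (w - t)) ∂σ).re =
      ∫ t, Complex.reCLM (Complex.log (1 + (z - w) / (w - t))) ∂σ :=
    (Complex.reCLM.integral_comp_comm (integrable_log_one_add hA hσ hr hw hz)).symm
  rw [toReal_sphPotential_of_notMem hA hσ hzA, toReal_sphPotential_of_notMem hA hσ hwA, hre,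
    ← integral_sub (hint w h0)
      (Complex.reCLM.integrable_comp (integrable_log_one_add hA hσ hr hw hz))]
  refine integral_congr_ae (hae.mono fun t ht => ?_)
  simp only [Complex.log_re, Complex.reCLM_apply]
  rw [one_add_div_eq (h0 t ht), norm_div, Real.log_div (norm_ne_zero_iff.2 (hz0 t ht))
    (norm_ne_zero_iff.2 (h0 t ht))]
  ring

end Holomorphic

/-! ### Maximum principle and domination for polynomials -/

theorem norm_eval_le_stretch_pow {p : Polynomial ℂ} {k : ℕ} (hp : p.natDegree ≤ k) :
    ∃ c : ℝ, 0 ≤ c ∧ ∀ z, ‖p.eval z‖ ≤ c * stretch z ^ k := by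
  refine ⟨∑ i ∈ Finset.range (p.natDegree + 1), ‖p.coeff i‖, by positivity, fun z => ?_⟩
  rw [Polynomial.eval_eq_sum_range, Finset.sum_mul]
  refine norm_sum_le_of_le _ fun i hi => ?_
  rw [norm_mul, norm_pow]
  have hi' : i ≤ k := (Nat.lt_succ_iff.1 (Finset.mem_range.1 hi)).trans hp
  gcongr
  exact (pow_le_pow_left₀ (norm_nonneg z) (norm_le_stretch z) i).trans
    (pow_le_pow_right₀ (one_le_stretch z) hi')

theorem tendsto_logStretch_cocompact : Tendsto logStretch (cocompact ℂ) atTop :=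
  Real.tendsto_log_atTop.comp
    (tendsto_atTop_mono norm_le_stretch tendsto_norm_cocompact_atTop)

/-- A maximum principle: a polynomial, weighted by the potential of a measure of mass greater than
one on a compact set, attains its maximal modulus on that set. -/
theorem norm_eval_mul_exp_le {σ : Measure ℂ} [IsFiniteMeasure σ] {A : Set ℂ} (hA : IsCompact A)
    (hσ : σ Aᶜ = 0) (hmass : 1 < (σ Set.univ).toReal)
    (hcont : Continuous fun z => (sphPotential σ z).toReal) {B : ℝ}
    (hB : ∀ z, (sphPotential σ z).toReal ≤ B) {p : Polynomial ℂ} {k : ℕ} (hk : k ≠ 0)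
    (hp : p.natDegree ≤ k) {c : ℝ}
    (hc : ∀ z ∈ A, ‖p.eval z‖ * Real.exp (k * ((sphPotential σ z).toReal -
      (σ Set.univ).toReal * logStretch z)) ≤ c) (z : ℂ) :
    ‖p.eval z‖ * Real.exp (k * ((sphPotential σ z).toReal -
      (σ Set.univ).toReal * logStretch z)) ≤ c := by
  set s := (σ Set.univ).toReal with hs
  set f : ℂ → ℝ := fun z => ‖p.eval z‖ * Real.exp (k * ((sphPotential σ z).toReal -
      s * logStretch z)) with hf
  have hf0 : ∀ z, 0 ≤ f z := fun z => by positivity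
  obtain ⟨a, ha⟩ : A.Nonempty := by
    by_contra h
    rw [Set.not_nonempty_iff_eq_empty] at h
    rw [h, Set.compl_empty] at hσ
    rw [hs, hσ, ENNReal.toReal_zero] at hmass
    linarith
  have hc0 : 0 ≤ c := (hf0 a).trans (hc a ha)
  have hfc : Continuous f := by
    have := p.continuous
    fun_prop
  have hk1 : (1 : ℝ) ≤ k := by exact_mod_cast Nat.one_le_iff_ne_zero.2 hk
  have hlim : Tendsto f (cocompact ℂ) (𝓝 0) := by
    obtain ⟨d, hd, hpd⟩ := norm_eval_le_stretch_pow hp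
    -- The polynomial grows at most like stretch^k while the weight decays like stretch^(-ks); mass
    -- s > 1 leaves a decaying factor.
    have hle : ∀ z, f z ≤ d * Real.exp (k * B) * Real.exp (-((s - 1) * logStretch z)) := by
      intro z
      have h1 : stretch z ^ k = Real.exp (k * logStretch z) := by
        rw [Real.exp_nat_mul, exp_logStretch]
      calc f z ≤ (d * stretch z ^ k) * Real.exp (k * (B - s * logStretch z)) := by
            simp only [hf]
            refine mul_le_mul (hpd z) (Real.exp_le_exp.2 ?_) (Real.exp_pos _).le
              ((norm_nonneg _).trans (hpd z))
            gcongr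
            exact hB z
        _ = d * Real.exp (k * B) * Real.exp (-(k * ((s - 1) * logStretch z))) := by
            rw [h1, mul_assoc, mul_assoc, ← Real.exp_add, ← Real.exp_add]
            congr 2
            ring
        _ ≤ _ := by
            have : 0 ≤ (s - 1) * logStretch z :=
              mul_nonneg (by linarith) (logStretch_nonneg z)
            refine mul_le_mul_of_nonneg_left (Real.exp_le_exp.2 ?_) (by positivity)
            nlinarith
    refine squeeze_zero hf0 hle ?_
    have h2 : Tendsto (fun z => Real.exp (-((s - 1) * logStretch z))) (cocompact ℂ) (𝓝 0) :=
      Real.tendsto_exp_neg_atTop_nhds_zero.comp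
        (tendsto_logStretch_cocompact.const_mul_atTop (by linarith))
    simpa using h2.const_mul (d * Real.exp (k * B))
  by_contra! hcon
  change c < f z at hcon
  obtain ⟨z₀, hz₀⟩ := hfc.exists_forall_ge' (x₀ := z)
    ((hlim.eventually_lt_const (hc0.trans_lt hcon)).mono fun y hy => hy.le)
  -- If the bound fails, the maximum exceeds c and is not attained on A. Off A, f is locally a
  -- constant times the modulus of a holomorphic function, so the maximum set is open as well as
  -- closed. By connectedness it is all of ℂ and meets A.
  have hclosed : IsClosed {y | f y = f z₀} := isClosed_eq hfc continuous_const
  have hopen : IsOpen {y | f y = f z₀} := by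
    rw [isOpen_iff_mem_nhds]
    intro w hw
    change f w = f z₀ at hw
    have hwA : w ∉ A := fun h => by
      have h1 : f w ≤ c := hc w h
      have h2 := hz₀ z
      linarith
    obtain ⟨R, hR, hRA⟩ := Metric.isOpen_iff.1 hA.isClosed.isOpen_compl w hwA
    have hdist : ∀ t ∈ A, 2 * (R / 2) ≤ ‖w - t‖ := by
      intro t ht
      by_contra! hlt
      refine hRA ?_ ht
      rw [mem_ball_iff_norm, norm_sub_rev]
      linarith
    have hr : 0 < R / 2 := by positivity
    set Φ : ℂ → ℂ := fun y => ∫ t, Complex.log (1 + (y - w) / (w - t)) ∂σ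
    have hΦ : DifferentiableOn ℂ Φ (Metric.ball w (R / 2)) :=
      differentiableOn_integral_log hA hσ hr hdist
    have hball : Metric.ball w (R / 2) ∈ 𝓝 w := Metric.ball_mem_nhds w hr
    set D := Real.exp (k * ((sphPotential σ w).toReal - s * logStretch w)) with hD
    have hDpos : 0 < D := Real.exp_pos _
    set F : ℂ → ℂ := fun y => p.eval y * Complex.exp (-(k * Φ y)) with hF
    have hfF : ∀ y ∈ Metric.ball w (R / 2), f y = ‖F y‖ * D := by
      intro y hy
      simp only [hf, hF, hD, hs]
      rw [toReal_sphPotential_eq_add_re hA hσ hr hdist hy, norm_mul, Complex.norm_exp, mul_assoc,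
        ← Real.exp_add]
      congr 2
      simp only [Complex.neg_re, Complex.mul_re, Complex.natCast_re, Complex.natCast_im, Φ]
      ring
    have hFd : ∀ᶠ y in 𝓝 w, DifferentiableAt ℂ F y := by
      filter_upwards [eventually_eventually_nhds.2 hball] with y hy
      have h1 := hΦ.differentiableAt hy
      have h2 : DifferentiableAt ℂ (fun y => p.eval y) y := p.differentiableAt
      exact h2.mul ((h1.const_mul _).neg.cexp)
    have hmax : IsLocalMax (norm ∘ F) w := by
      filter_upwards [hball] with y hy
      have h1 := hz₀ y
      rw [← hw, hfF y hy, hfF w (Metric.mem_ball_self hr)] at h1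
      exact le_of_mul_le_mul_right h1 hDpos
    filter_upwards [hball, Complex.eventually_eq_of_isLocalMax_norm hFd hmax] with y hy hyF
    rw [← hw, hfF y hy, hfF w (Metric.mem_ball_self hr), hyF]
  have huniv := IsClopen.eq_univ ⟨hclosed, hopen⟩ ⟨z₀, rfl⟩
  have hfa : f a = f z₀ := by
    have : a ∈ {y | f y = f z₀} := by rw [huniv]; trivial
    exact this
  have h1 : f a ≤ c := hc a ha
  have h2 := hz₀ z
  linarith

theorem sphPotential_eq_iSup (μ : Measure ℂ) (z : ℂ) :
    sphPotential μ z = ⨆ m : ℕ, ∫⁻ t, min (kernel z t) m ∂μ := by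
  rw [← lintegral_iSup (fun m => (measurable_kernel_right z).min measurable_const)
    (fun m n hmn t => min_le_min le_rfl (by exact_mod_cast hmn))]
  refine lintegral_congr fun t => ?_
  rw [← inf_iSup_eq, ENNReal.iSup_natCast, inf_top_eq]

/-- The principle of domination for a polynomial: an upper bound for the weighted modulus that
holds almost everywhere for a measure of finite energy holds in the whole plane. -/
theorem norm_eval_mul_exp_le_of_ae {μ : Measure ℂ} [IsProbabilityMeasure μ]
    (hμ : sphEnergy μ μ ≠ ⊤) {p : Polynomial ℂ} {k : ℕ} (hk : k ≠ 0) (hp : p.natDegree ≤ k)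
    {c : ℝ} (hc : ∀ᵐ z ∂μ, sphPotential μ z ≠ ⊤ ∧
      ‖p.eval z‖ * Real.exp (k * ((sphPotential μ z).toReal - logStretch z)) ≤ c)
    {z : ℂ} {r : ℝ} (hr : (r : EReal) < (sphPotential μ z : EReal)) :
    ‖p.eval z‖ * Real.exp (k * (r - logStretch z)) ≤ c := by
  obtain ⟨A₀, hA₀T, hA₀, hA₀μ, hfin₀, hcont₀, B₀, hB₀⟩ :=
    exists_isCompact_continuous_sphPotential hμ hc one_half_pos
  have hcompl : ∀ {A : Set ℂ} {ε : ℝ}, IsCompact A → 0 < ε → μ Aᶜ ≤ ENNReal.ofReal ε →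
      1 - ε ≤ (μ A).toReal := by
    intro A ε hA hε h
    have h1 : (μ A).toReal = 1 - (μ Aᶜ).toReal := by
      have := probReal_compl_eq_one_sub (μ := μ) hA.measurableSet
      simp only [Measure.real] at this
      linarith
    have h2 := ENNReal.toReal_mono ENNReal.ofReal_ne_top h
    rw [ENNReal.toReal_ofReal hε.le] at h2
    linarith
  have hmass₀ := hcompl hA₀ one_half_pos hA₀μ
  have hle1 : ∀ A : Set ℂ, (μ A).toReal ≤ 1 := fun A => measureReal_le_one
  have hBnn : 0 ≤ B₀ := ENNReal.toReal_nonneg.trans (hB₀ 0)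
  -- Once m is fixed, discarding the part of μ off A lowers the truncated potential at z by at most
  -- mε.
  obtain ⟨m, hm⟩ : ∃ m : ℕ, ENNReal.ofReal r ≤ ∫⁻ t, min (kernel z t) m ∂μ := by
    rcases le_or_gt r 0 with h | h
    · exact ⟨0, by simp [ENNReal.ofReal_of_nonpos h]⟩
    · rw [← max_eq_left h.le, ← EReal.coe_ennreal_ofReal, EReal.coe_ennreal_lt_coe_ennreal_iff,
        sphPotential_eq_iSup] at hr
      obtain ⟨m, hm⟩ := lt_iSup_iff.1 hr
      exact ⟨m, hm.le⟩
  have key : ∀ ε : ℝ, 0 < ε →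
      ‖p.eval z‖ * Real.exp (k * (r - m * ε - (1 + 4 * ε) * logStretch z)) ≤
        c * Real.exp (k * (4 * ε * B₀)) := by
    intro ε hε
    obtain ⟨A, hAT, hA, hAμ, hfin, hcont, B, hB⟩ :=
      exists_isCompact_continuous_sphPotential hμ hc hε
    have hmass := hcompl hA hε hAμ
    -- The added copy brings the mass to at least (1 - ε) + 4ε · ½ = 1 + ε. Since A₀ and B₀ do not
    -- depend on ε, its contribution 4εB₀ vanishes in the limit; the bound B for A may blow up but
    -- never enters the estimate.
    set σ : Measure ℂ := μ.restrict A + ENNReal.ofReal (4 * ε) • μ.restrict A₀ with hσ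
    have hσfin : IsFiniteMeasure σ := by
      have : IsFiniteMeasure (ENNReal.ofReal (4 * ε) • μ.restrict A₀) :=
        (μ.restrict A₀).smul_finite ENNReal.ofReal_ne_top
      infer_instance
    have hσA : σ (A ∪ A₀)ᶜ = 0 := by
      have hm := (hA.union hA₀).measurableSet.compl
      have h1 : μ.restrict A (A ∪ A₀)ᶜ = 0 := by
        rw [Measure.restrict_apply hm, show (A ∪ A₀)ᶜ ∩ A = ∅ by ext; simp; tauto, measure_empty]
      have h2 : μ.restrict A₀ (A ∪ A₀)ᶜ = 0 := by
        rw [Measure.restrict_apply hm, show (A ∪ A₀)ᶜ ∩ A₀ = ∅ by ext; simp, measure_empty]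
      rw [hσ, Measure.add_apply, Measure.smul_apply, h1, h2, smul_zero, add_zero]
    have hs : (σ Set.univ).toReal = (μ A).toReal + 4 * ε * (μ A₀).toReal := by
      simp only [hσ, Measure.add_apply, Measure.smul_apply, Measure.restrict_apply_univ,
        smul_eq_mul]
      rw [ENNReal.toReal_add (measure_ne_top _ _)
        (ENNReal.mul_ne_top ENNReal.ofReal_ne_top (measure_ne_top _ _)), ENNReal.toReal_mul,
        ENNReal.toReal_ofReal (by positivity)]
    have hG : ∀ y, (sphPotential σ y).toReal = (sphPotential (μ.restrict A) y).toReal +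
        4 * ε * (sphPotential (μ.restrict A₀) y).toReal := by
      intro y
      rw [hσ, sphPotential_add, sphPotential_smul, ENNReal.toReal_add (hfin y)
        (ENNReal.mul_ne_top ENNReal.ofReal_ne_top (hfin₀ y)), ENNReal.toReal_mul,
        ENNReal.toReal_ofReal (by positivity)]
    have hs1 : 1 < (σ Set.univ).toReal := by rw [hs]; nlinarith
    have hs2 : (σ Set.univ).toReal ≤ 1 + 4 * ε := by
      rw [hs]; nlinarith [hle1 A, hle1 A₀]
    have hmain := norm_eval_mul_exp_le (hA.union hA₀) hσA hs1
      (by simp only [hG]; fun_prop) (B := B + 4 * ε * B₀)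
      (fun y => by rw [hG]; have := hB y; have := hB₀ y; gcongr) hk hp
      (c := c * Real.exp (k * (4 * ε * B₀))) (fun y hy => by
        obtain ⟨hyfin, hyc⟩ : sphPotential μ y ≠ ⊤ ∧
            ‖p.eval y‖ * Real.exp (k * ((sphPotential μ y).toReal - logStretch y)) ≤ c :=
          hy.elim (fun h => hAT h) fun h => hA₀T h
        have h1 : (sphPotential (μ.restrict A) y).toReal ≤ (sphPotential μ y).toReal :=
          ENNReal.toReal_mono hyfin (sphPotential_mono Measure.restrict_le_self y)
        have h2 : (sphPotential σ y).toReal - (σ Set.univ).toReal * logStretch y ≤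
            ((sphPotential μ y).toReal - logStretch y) + 4 * ε * B₀ := by
          rw [hG]
          nlinarith [logStretch_nonneg y, hB₀ y]
        calc _ ≤ ‖p.eval y‖ * Real.exp (k * (((sphPotential μ y).toReal - logStretch y) +
              4 * ε * B₀)) := by gcongr
          _ = (‖p.eval y‖ * Real.exp (k * ((sphPotential μ y).toReal - logStretch y))) *
              Real.exp (k * (4 * ε * B₀)) := by
            rw [mul_add (k : ℝ), Real.exp_add, ← mul_assoc]
          _ ≤ _ := by gcongr) z
    refine le_trans ?_ hmain
    have h3 : ∫⁻ t, min (kernel z t) m ∂μ ≤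
        sphPotential (μ.restrict A) z + m * ENNReal.ofReal ε := by
      rw [← lintegral_add_compl _ hA.measurableSet]
      refine add_le_add (lintegral_mono fun t => min_le_left _ _) ?_
      calc _ ≤ ∫⁻ _ in Aᶜ, (m : ℝ≥0∞) ∂μ := lintegral_mono fun t => min_le_right _ _
        _ = m * μ Aᶜ := setLIntegral_const _ _
        _ ≤ _ := by gcongr
    have h4 : r ≤ (sphPotential (μ.restrict A) z).toReal + m * ε := by
      have h5 := ENNReal.toReal_mono (ENNReal.add_ne_top.2 ⟨hfin z,
        ENNReal.mul_ne_top (ENNReal.natCast_ne_top m) ENNReal.ofReal_ne_top⟩) (hm.trans h3)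
      rw [ENNReal.toReal_add (hfin z)
        (ENNReal.mul_ne_top (ENNReal.natCast_ne_top m) ENNReal.ofReal_ne_top),
        ENNReal.toReal_mul, ENNReal.toReal_natCast, ENNReal.toReal_ofReal hε.le,
        ENNReal.toReal_ofReal'] at h5
      exact (le_max_left _ _).trans h5
    have h6 : r - m * ε - (1 + 4 * ε) * logStretch z ≤
        (sphPotential σ z).toReal - (σ Set.univ).toReal * logStretch z := by
      have h7 : 0 ≤ 4 * ε * (sphPotential (μ.restrict A₀) z).toReal := by positivity
      rw [hG]
      nlinarith [logStretch_nonneg z]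
    gcongr
  have hl : Tendsto (fun ε : ℝ => ‖p.eval z‖ *
      Real.exp (k * (r - m * ε - (1 + 4 * ε) * logStretch z))) (𝓝[>] 0)
      (𝓝 (‖p.eval z‖ * Real.exp (k * (r - logStretch z)))) := by
    have : Continuous fun ε : ℝ => ‖p.eval z‖ *
      Real.exp (k * (r - m * ε - (1 + 4 * ε) * logStretch z)) := by fun_prop
    simpa using (this.tendsto 0).mono_left nhdsWithin_le_nhds
  have hrt : Tendsto (fun ε : ℝ => c * Real.exp (k * (4 * ε * B₀))) (𝓝[>] 0) (𝓝 c) := by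
    have : Continuous fun ε : ℝ => c * Real.exp (k * (4 * ε * B₀)) := by fun_prop
    simpa using (this.tendsto 0).mono_left nhdsWithin_le_nhds
  exact le_of_tendsto_of_tendsto hl hrt (eventually_nhdsWithin_of_forall key)

theorem eval_eq_zero_of_ae {μ : Measure ℂ} [IsProbabilityMeasure μ]
    (hμ : sphEnergy μ μ ≠ ⊤) {p : Polynomial ℂ} {k : ℕ} (hk : k ≠ 0) (hp : p.natDegree ≤ k)
    {c : ℝ} (hc : ∀ᵐ z ∂μ, sphPotential μ z ≠ ⊤ ∧
      ‖p.eval z‖ * Real.exp (k * ((sphPotential μ z).toReal - logStretch z)) ≤ c)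
    {z : ℂ} (hz : sphPotential μ z = ⊤) : p.eval z = 0 := by
  by_contra h
  have hpos : 0 < ‖p.eval z‖ := norm_pos_iff.2 h
  have hk0 : (k : ℝ) ≠ 0 := by exact_mod_cast hk
  have h1 := norm_eval_mul_exp_le_of_ae hμ hk hp hc (z := z)
    -- An infinite potential allows any r. This one would give |p| exp(c/|p|) ≤ c, whereas exp x ≥ 1
    -- + x makes the left side at least |p| + c.
    (r := logStretch z + c / ‖p.eval z‖ / k) (by rw [hz]; exact EReal.coe_lt_top _)
  rw [add_sub_cancel_left, mul_div_cancel₀ _ hk0] at h1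
  have h2 := mul_le_mul_of_nonneg_left (Real.add_one_le_exp (c / ‖p.eval z‖)) hpos.le
  rw [mul_add, mul_div_cancel₀ _ hpos.ne'] at h2
  linarith

theorem norm_eval_mul_exp_sphPotential_le_of_ae {μ : Measure ℂ} [IsProbabilityMeasure μ]
    (hμ : sphEnergy μ μ ≠ ⊤) {p : Polynomial ℂ} {k : ℕ} (hk : k ≠ 0) (hp : p.natDegree ≤ k)
    {c : ℝ} (hc : ∀ᵐ z ∂μ, sphPotential μ z ≠ ⊤ ∧
      ‖p.eval z‖ * Real.exp (k * ((sphPotential μ z).toReal - logStretch z)) ≤ c)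
    {z : ℂ} (hz : sphPotential μ z ≠ ⊤) :
    ‖p.eval z‖ * Real.exp (k * ((sphPotential μ z).toReal - logStretch z)) ≤ c := by
  have hcont : Continuous fun r : ℝ => ‖p.eval z‖ * Real.exp (k * (r - logStretch z)) := by
    fun_prop
  refine le_of_tendsto ((hcont.tendsto _).mono_left nhdsWithin_le_nhds)
    (eventually_nhdsWithin_of_forall (s := Set.Iio (sphPotential μ z).toReal) fun r hr => ?_)
  refine norm_eval_mul_exp_le_of_ae hμ hk hp hc ?_
  rw [← ENNReal.ofReal_toReal hz, EReal.coe_ennreal_ofReal, max_eq_left ENNReal.toReal_nonneg]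
  exact EReal.coe_lt_coe_iff.2 hr

/-! ### From the weight to a spherical field -/

/-- Far out, the finite lower limit bounds Q below by log|z| plus a constant. On the remaining
compact part of K, Q attains its minimum, which is not -∞. -/
theorem WeaklyAdmissible.exists_le {K : Set ℂ} {Q : ℂ → EReal} (hK : IsClosed K)
    (hQ : WeaklyAdmissible K Q) :
    ∃ C : ℝ, 0 ≤ C ∧ ∀ z ∈ K, ((logStretch z - C : ℝ) : EReal) ≤ Q z := by
  obtain ⟨m, hm⟩ := hQ.liminf_eq
  have hev : ∀ᶠ z in Bornology.cobounded ℂ ⊓ 𝓟 K,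
      ((m - 1 : ℝ) : EReal) < Q z - ((Real.log ‖z‖ : ℝ) : EReal) := by
    refine eventually_lt_of_lt_liminf ?_
    rw [hm]
    exact EReal.coe_lt_coe_iff.2 (by linarith)
  rw [eventually_inf_principal, ← comap_norm_atTop, eventually_comap] at hev
  obtain ⟨R, hR⟩ := eventually_atTop.1 hev
  have hfar : ∀ z ∈ K, max R 1 ≤ ‖z‖ →
      ((logStretch z - (Real.log 2 + 1 - m) : ℝ) : EReal) ≤ Q z := by
    intro z hz hzR
    have h1 := hR ‖z‖ ((le_max_left _ _).trans hzR) z rfl hz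
    have hz1 : 1 ≤ ‖z‖ := (le_max_right _ _).trans hzR
    have h2 : logStretch z ≤ Real.log 2 + Real.log ‖z‖ := by
      rw [logStretch, ← Real.log_mul two_ne_zero (by positivity)]
      refine Real.log_le_log (stretch_pos z) ?_
      exact Real.sqrt_le_iff.2 ⟨by positivity, by nlinarith⟩
    rw [EReal.lt_sub_iff_add_lt (by simp) (by simp), ← EReal.coe_add] at h1
    refine le_trans (EReal.coe_le_coe_iff.2 ?_) h1.le
    linarith
  have hnear : ∃ D : ℝ, ∀ z ∈ K, ‖z‖ ≤ max R 1 → ((logStretch z - D : ℝ) : EReal) ≤ Q z := by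
    have hcomp : IsCompact (K ∩ Metric.closedBall 0 (max R 1)) :=
      (isCompact_closedBall _ _).inter_left hK
    rcases (K ∩ Metric.closedBall (0 : ℂ) (max R 1)).eq_empty_or_nonempty with he | hne
    · refine ⟨0, fun z hz hzR => ?_⟩
      have : z ∈ K ∩ Metric.closedBall (0 : ℂ) (max R 1) := ⟨hz, by simpa using hzR⟩
      rw [he] at this
      exact this.elim
    · obtain ⟨z₀, hz₀, hmin⟩ := (hQ.lowerSemicontinuousOn.mono Set.inter_subset_left).exists_isMinOn
        hne hcomp
      obtain ⟨B, hB⟩ := hcomp.exists_bound_of_continuousOn continuous_logStretch.continuousOn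
      obtain ⟨v, -, hv⟩ := EReal.lt_iff_exists_real_btwn.1
        (bot_lt_iff_ne_bot.2 (hQ.ne_bot z₀ hz₀.1))
      refine ⟨B - v, fun z hz hzR => ?_⟩
      have hz' : z ∈ K ∩ Metric.closedBall (0 : ℂ) (max R 1) := ⟨hz, by simpa using hzR⟩
      refine le_trans (le_trans (EReal.coe_le_coe_iff.2 ?_) hv.le) (hmin hz')
      linarith [(le_abs_self _).trans (hB z hz')]
  obtain ⟨D, hD⟩ := hnear
  refine ⟨max 0 (max D (Real.log 2 + 1 - m)), le_max_left _ _, fun z hz => ?_⟩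
  rcases le_total ‖z‖ (max R 1) with h | h
  · refine le_trans (EReal.coe_le_coe_iff.2 ?_) (hD z hz h)
    linarith [(le_max_left D (Real.log 2 + 1 - m)).trans (le_max_right 0 _)]
  · refine le_trans (EReal.coe_le_coe_iff.2 ?_) (hfar z hz h)
    linarith [(le_max_right D (Real.log 2 + 1 - m)).trans (le_max_right 0 _)]

open Classical in
/-- The external field on the sphere that corresponds to the weight `Q` on `K`, raised by `C`. -/
def sphField (K : Set ℂ) (Q : ℂ → EReal) (C : ℝ) (z : ℂ) : ℝ≥0∞ :=
  if z ∈ K then (Q z + ((C - logStretch z : ℝ) : EReal)).toENNReal else ⊤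

section Field

variable {K : Set ℂ} {Q : ℂ → EReal} {C : ℝ}

/-- Closedness of K is what keeps the extension by `⊤` lower semicontinuous. -/
theorem lowerSemicontinuous_sphField (hK : IsClosed K) (hQ : LowerSemicontinuousOn Q K) :
    LowerSemicontinuous (sphField K Q C) := by
  have hcont : Continuous fun z => ((C - logStretch z : ℝ) : EReal) :=
    continuous_coe_real_ereal.comp (by fun_prop)
  have hsum : LowerSemicontinuousOn (fun z => Q z + ((C - logStretch z : ℝ) : EReal)) K :=
    hQ.add' (hcont.lowerSemicontinuous.lowerSemicontinuousOn K) fun z _ =>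
      EReal.continuousAt_add (Or.inr (EReal.coe_ne_bot _)) (Or.inr (EReal.coe_ne_top _))
  have hlsc := EReal.continuous_toENNReal.comp_lowerSemicontinuousOn hsum
    fun _ _ => EReal.toENNReal_le_toENNReal
  intro z y hy
  by_cases hz : z ∈ K
  · have h1 : y < (Q z + ((C - logStretch z : ℝ) : EReal)).toENNReal := by
      simpa [sphField, hz] using hy
    filter_upwards [eventually_nhdsWithin_iff.1 (hlsc z hz y h1)] with x hx
    by_cases hxK : x ∈ K
    · simpa [sphField, hxK] using hx hxK
    · simpa [sphField, hxK] using lt_top_of_lt hy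
  · filter_upwards [hK.isOpen_compl.mem_nhds hz] with x hx
    rw [sphField, if_neg hx]
    exact lt_top_of_lt hy

theorem mem_of_sphField_ne_top {z : ℂ} (h : sphField K Q C z ≠ ⊤) : z ∈ K := by
  by_contra hz
  exact h (if_neg hz)

theorem sphField_eq_top {z : ℂ} (hz : z ∈ K) (h : sphField K Q C z = ⊤) : Q z = ⊤ := by
  rw [sphField, if_pos hz, EReal.toENNReal_eq_top_iff] at h
  by_contra hQ
  exact (EReal.add_lt_top hQ (EReal.coe_ne_top _)).ne h

theorem coe_sphField_add_logStretch {z : ℂ} (hz : z ∈ K)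
    (h : ((logStretch z - C : ℝ) : EReal) ≤ Q z) (hC0 : 0 ≤ C) :
    Q z = ((sphField K Q C z + ENNReal.ofReal (logStretch z) : ℝ≥0∞) : EReal) -
      ((ENNReal.ofReal C : ℝ≥0∞) : EReal) := by
  rw [sphField, if_pos hz, EReal.coe_ennreal_add, EReal.coe_ennreal_ofReal,
    EReal.coe_ennreal_ofReal, max_eq_left (logStretch_nonneg z), max_eq_left hC0]
  induction hQz : Q z with
  | bot =>
    rw [hQz] at h
    exact absurd (le_bot_iff.1 h) (EReal.coe_ne_bot _)
  | top => rw [EReal.top_add_coe, EReal.toENNReal_top, EReal.coe_ennreal_top, EReal.top_add_coe,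
      EReal.top_sub_coe]
  | coe x =>
    rw [hQz, EReal.coe_le_coe_iff] at h
    rw [← EReal.coe_add, EReal.coe_toENNReal (by
      exact_mod_cast (by linarith : 0 ≤ x + (C - logStretch z))),
      ← EReal.coe_add, ← EReal.coe_sub]
    congr 1
    ring

theorem eq_coe_of_sphField_ne_top {z : ℂ} (hz : sphField K Q C z ≠ ⊤)
    (h : ((logStretch z - C : ℝ) : EReal) ≤ Q z) (hC0 : 0 ≤ C) :
    Q z = (((sphField K Q C z).toReal + logStretch z - C : ℝ) : EReal) := by
  rw [coe_sphField_add_logStretch (mem_of_sphField_ne_top hz) h hC0]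
  rw [EReal.coe_ennreal_add, EReal.coe_ennreal_ofReal,
    EReal.coe_ennreal_ofReal, max_eq_left (logStretch_nonneg z), max_eq_left hC0,
    ← EReal.coe_ennreal_toReal hz]
  norm_cast

/-- The stretching terms in the kernel cancel those in the two fields, leaving one constant C per
point. -/
theorem log_inv_mul_weight {z t : ℂ} (hz : z ∈ K) (ht : t ∈ K)
    (hzC : ((logStretch z - C : ℝ) : EReal) ≤ Q z) (htC : ((logStretch t - C : ℝ) : EReal) ≤ Q t)
    (hC0 : 0 ≤ C) :
    ENNReal.log (‖z - t‖ₑ * weight Q z * weight Q t)⁻¹ =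
      ((kernel z t + (sphField K Q C z + sphField K Q C t) : ℝ≥0∞) : EReal) -
        ((ENNReal.ofReal (2 * C) : ℝ≥0∞) : EReal) := by
  have hC2 : ((ENNReal.ofReal (2 * C) : ℝ≥0∞) : EReal) = ((2 * C : ℝ) : EReal) := by
    rw [EReal.coe_ennreal_ofReal, max_eq_left (by positivity)]
  have htop : ((⊤ : ℝ≥0∞) : EReal) - ((2 * C : ℝ) : EReal) = ⊤ := by
    rw [EReal.coe_ennreal_top, EReal.top_sub_coe]
  rw [hC2]
  by_cases hzt : z = t
  · rw [hzt, kernel_self, top_add, htop]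
    simp
  by_cases hz1 : sphField K Q C z = ⊤
  · rw [hz1, top_add, add_top, htop]
    simp [weight, sphField_eq_top hz hz1]
  by_cases ht1 : sphField K Q C t = ⊤
  · rw [ht1, add_top, add_top, htop]
    simp [weight, sphField_eq_top ht ht1]
  have h0 : 0 < ‖z - t‖ := norm_pos_iff.2 (sub_ne_zero.2 hzt)
  rw [weight, weight, eq_coe_of_sphField_ne_top hz1 hzC hC0, eq_coe_of_sphField_ne_top ht1 htC hC0,
    ← EReal.coe_neg, ← EReal.coe_neg, EReal.exp_coe, EReal.exp_coe, ← ofReal_norm,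
    ← ENNReal.ofReal_mul (by positivity), ← ENNReal.ofReal_mul (by positivity),
    ← ENNReal.ofReal_inv_of_pos (by positivity), ENNReal.log_ofReal_of_pos (by positivity),
    Real.log_inv, Real.log_mul (by positivity) (by positivity),
    Real.log_mul (by positivity) (by positivity), Real.log_exp, Real.log_exp]
  rw [EReal.coe_ennreal_add, EReal.coe_ennreal_add, ← EReal.coe_ennreal_toReal hz1,
    ← EReal.coe_ennreal_toReal ht1, kernel_of_ne hzt, EReal.coe_ennreal_ofReal,
    max_eq_left (by linarith [log_chord_nonpos z t]), log_chord hzt]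
  norm_cast
  ring_nf

theorem weightedEnergy_eq (hK : IsClosed K) (hQ : LowerSemicontinuousOn Q K)
    (hC : ∀ z ∈ K, ((logStretch z - C : ℝ) : EReal) ≤ Q z) (hC0 : 0 ≤ C) {ν : Measure ℂ}
    (hν : ν ∈ probOn K) :
    weightedEnergy Q ν = (fieldEnergy (sphField K Q C) ν : EReal) - ((2 * C : ℝ) : EReal) := by
  obtain ⟨hp, hνK⟩ := hν
  have hq : Measurable (sphField K Q C) := (lowerSemicontinuous_sphField hK hQ).measurable
  have hae : ∀ᵐ z ∂ν, z ∈ K := by rw [ae_iff]; exact hνK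
  have h1 : ∀ᵐ x ∂(ν.prod ν), x.1 ∈ K := Measure.quasiMeasurePreserving_fst.ae hae
  have h2 : ∀ᵐ x ∂(ν.prod ν), x.2 ∈ K := Measure.quasiMeasurePreserving_snd.ae hae
  rw [weightedEnergy, eintegral_eq_of_sub
    (a := fun x : ℂ × ℂ => kernel x.1 x.2 + (sphField K Q C x.1 + sphField K Q C x.2))
    (b := fun _ => ENNReal.ofReal (2 * C)) ?_ aemeasurable_const
    (by rw [lintegral_const, measure_univ, mul_one]; exact ENNReal.ofReal_ne_top) ?_,
    ← fieldEnergy_eq_prod hq.aemeasurable]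
  · rw [lintegral_const, measure_univ, mul_one, EReal.coe_ennreal_ofReal,
      max_eq_left (by positivity)]
  · exact (measurable_kernel.add ((hq.comp measurable_fst).add
      (hq.comp measurable_snd))).aemeasurable
  · filter_upwards [h1, h2] with x hx1 hx2
    exact log_inv_mul_weight hx1 hx2 (hC _ hx1) (hC _ hx2) hC0

theorem mem_probOn_of_fieldEnergy_ne_top (hq : Measurable (sphField K Q C)) {ν : Measure ℂ}
    (hp : IsProbabilityMeasure ν) (hν : fieldEnergy (sphField K Q C) ν ≠ ⊤) : ν ∈ probOn K := by
  refine ⟨hp, ?_⟩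
  have hX : ∫⁻ z, sphField K Q C z ∂ν ≠ ⊤ := by
    intro h
    simp [fieldEnergy, h] at hν
  have hae : ∀ᵐ z ∂ν, z ∈ K := (ae_lt_top hq hX).mono fun z hz => mem_of_sphField_ne_top hz.ne
  rw [ae_iff] at hae
  exact hae

/-- Nonpolarity supplies a measure of finite energy on a compact set where q is finite. It charges
some level set {q ≤ n}; normalising it there also makes ∫ q finite. -/
theorem exists_fieldEnergy_ne_top (hq : Measurable (sphField K Q C))
    (hQ : ¬ IsPolar {z ∈ K | Q z < ⊤}) :
    ∃ ν : Measure ℂ, IsProbabilityMeasure ν ∧ fieldEnergy (sphField K Q C) ν ≠ ⊤ := by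
  unfold IsPolar at hQ
  push Not at hQ
  obtain ⟨D, hD, hDQ, ν, hν, hE⟩ := hQ
  have hE' : sphEnergy ν ν ≠ ⊤ := fun h => hE ((energy_eq_top_iff hD hν).2 h)
  obtain ⟨hp, hνD⟩ := hν
  obtain ⟨n, hn⟩ : ∃ n : ℕ, ν {z | sphField K Q C z ≤ n} ≠ 0 := by
    by_contra! hcon
    have h1 : ν (⋃ n : ℕ, {z | sphField K Q C z ≤ n}) = 0 := measure_iUnion_null hcon
    have h2 : D ⊆ ⋃ n : ℕ, {z | sphField K Q C z ≤ n} := by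
      intro z hz
      have hfin : sphField K Q C z ≠ ⊤ := fun h =>
        (hDQ hz).2.ne (sphField_eq_top (hDQ hz).1 h)
      obtain ⟨n, hn⟩ := ENNReal.exists_nat_gt hfin
      exact Set.mem_iUnion.2 ⟨n, hn.le⟩
    have h3 : ν Set.univ = 0 := by
      rw [← Set.union_compl_self D]
      exact measure_union_null (measure_mono_null h2 h1) hνD
    simp at h3
  have hAm : MeasurableSet {z | sphField K Q C z ≤ n} := measurableSet_le hq measurable_const
  have hmem := condOn_mem_probOn hAm hn
  have hprob := hmem.1
  refine ⟨condOn ν {z | sphField K Q C z ≤ n}, hprob, ?_⟩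
  refine ENNReal.add_ne_top.2 ⟨sphEnergy_condOn_ne_top hn hE', ENNReal.mul_ne_top (by simp) ?_⟩
  refine ne_top_of_le_ne_top (ENNReal.natCast_ne_top n) ?_
  calc _ ≤ ∫⁻ _, (n : ℝ≥0∞) ∂(condOn ν {z | sphField K Q C z ≤ n}) := by
        have hae : ∀ᵐ z ∂(condOn ν {z | sphField K Q C z ≤ n}),
            z ∈ {z | sphField K Q C z ≤ n} := by
          rw [ae_iff]; exact hmem.2
        exact lintegral_mono_ae hae
    _ = n := by simp

end Field

/-! ### The equilibrium measure and its constants -/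

/-- The equilibrium measure exists and minimises the energy on the sphere. -/
theorem equilibriumMeasure_spec {K : Set ℂ} {Q : ℂ → EReal} {C : ℝ} (hK : IsClosed K)
    (hQ : WeaklyAdmissible K Q) (hC : ∀ z ∈ K, ((logStretch z - C : ℝ) : EReal) ≤ Q z)
    (hC0 : 0 ≤ C) :
    IsEquilibrium K Q (equilibriumMeasure K Q) ∧
    fieldEnergy (sphField K Q C) (equilibriumMeasure K Q) ≠ ⊤ ∧
    ∀ ν : Measure ℂ, IsProbabilityMeasure ν →
      fieldEnergy (sphField K Q C) (equilibriumMeasure K Q) ≤ fieldEnergy (sphField K Q C) ν := by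
  have hlsc := lowerSemicontinuous_sphField (C := C) hK hQ.lowerSemicontinuousOn
  have hfin := exists_fieldEnergy_ne_top hlsc.measurable hQ.nonpolar
  obtain ⟨ν₀, hν₀, hν₀fin⟩ := hfin
  obtain ⟨μ₁, hμ₁, hmin⟩ := exists_fieldEnergy_le hlsc ⟨ν₀, hν₀, hν₀fin⟩
  have hμ₁fin : fieldEnergy (sphField K Q C) μ₁ ≠ ⊤ :=
    ne_top_of_le_ne_top hν₀fin (hmin ν₀ hν₀)
  have hμ₁K := mem_probOn_of_fieldEnergy_ne_top hlsc.measurable hμ₁ hμ₁fin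
  have hW := fun {ν : Measure ℂ} (hν : ν ∈ probOn K) =>
    weightedEnergy_eq hK hQ.lowerSemicontinuousOn hC hC0 hν
  have hex : ∃ μ, IsEquilibrium K Q μ := by
    refine ⟨μ₁, hμ₁K, le_antisymm (le_iInf₂ fun ν hν => ?_) (iInf₂_le μ₁ hμ₁K)⟩
    rw [hW hμ₁K, hW hν]
    exact EReal.sub_le_sub (EReal.coe_ennreal_le_coe_ennreal_iff.2 (hmin ν hν.1)) le_rfl
  have heq : IsEquilibrium K Q (equilibriumMeasure K Q) := by
    rw [equilibriumMeasure, dif_pos hex]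
    exact hex.choose_spec
  refine ⟨heq, ?_⟩
  -- The measure picked by choice may be any minimiser; comparison with μ₁ suffices, so uniqueness
  -- plays no role.
  have hle : fieldEnergy (sphField K Q C) (equilibriumMeasure K Q) ≤
      fieldEnergy (sphField K Q C) μ₁ := by
    have h1 : weightedEnergy Q (equilibriumMeasure K Q) ≤ weightedEnergy Q μ₁ := by
      rw [heq.2]; exact iInf₂_le μ₁ hμ₁K
    rw [hW heq.1, hW hμ₁K] at h1
    have h2 := add_le_add_left h1 ((2 * C : ℝ) : EReal)
    rw [EReal.sub_add_cancel, EReal.sub_add_cancel] at h2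
    exact EReal.coe_ennreal_le_coe_ennreal_iff.1 h2
  exact ⟨ne_top_of_le_ne_top hμ₁fin hle, fun ν hν => hle.trans (hmin ν hν)⟩

section Equilibrium

variable {K : Set ℂ} {Q : ℂ → EReal} {C : ℝ}

theorem measurable_ofReal_logStretch : Measurable fun z => ENNReal.ofReal (logStretch z) := by
  fun_prop

/-- The finite logarithmic moment rules out ∞ - ∞ when the planar kernel is split. -/
theorem potential_eq {μ : Measure ℂ} [IsProbabilityMeasure μ]
    (hL : ∫⁻ z, ENNReal.ofReal (logStretch z) ∂μ ≠ ⊤) (z : ℂ) :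
    potential μ z = (sphPotential μ z : EReal) -
      ((logStretch z + (∫⁻ z, ENNReal.ofReal (logStretch z) ∂μ).toReal : ℝ) : EReal) := by
  have hb : ∫⁻ t, (ENNReal.ofReal (logStretch z) + ENNReal.ofReal (logStretch t)) ∂μ =
      ENNReal.ofReal (logStretch z) + ∫⁻ t, ENNReal.ofReal (logStretch t) ∂μ := by
    rw [lintegral_add_left measurable_const]; simp
  rw [potential, eintegral_eq_of_sub (a := kernel z)
    (b := fun t => ENNReal.ofReal (logStretch z) + ENNReal.ofReal (logStretch t))
    (measurable_kernel_right z).aemeasurable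
    (measurable_const.add measurable_ofReal_logStretch).aemeasurable
    (by rw [hb]; exact ENNReal.add_ne_top.2 ⟨ENNReal.ofReal_ne_top, hL⟩)
    (Eventually.of_forall fun t => log_inv_enorm_sub z t), hb, sphPotential]
  rw [EReal.coe_ennreal_add, EReal.coe_ennreal_ofReal, max_eq_left (logStretch_nonneg z),
    EReal.coe_add, EReal.coe_ennreal_toReal hL]

/-- Write ℓ for the logarithmic moment and I for the spherical self-energy. Then V_w = I + 2∫q - 2C
and ∫Q = ∫q + ℓ - C, while F = I + ∫q. -/
theorem robinConst_eq (hK : IsClosed K) (hQ : WeaklyAdmissible K Q)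
    (hC : ∀ z ∈ K, ((logStretch z - C : ℝ) : EReal) ≤ Q z) (hC0 : 0 ≤ C)
    (hL : ∫⁻ z, ENNReal.ofReal (logStretch z) ∂(equilibriumMeasure K Q) ≠ ⊤) :
    robinConst K Q = (((∫⁻ z, (sphPotential (equilibriumMeasure K Q) z + sphField K Q C z)
      ∂(equilibriumMeasure K Q)).toReal -
      (∫⁻ z, ENNReal.ofReal (logStretch z) ∂(equilibriumMeasure K Q)).toReal - C : ℝ) : EReal) := by
  obtain ⟨heq, hfin, -⟩ := equilibriumMeasure_spec hK hQ hC hC0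
  have hq : Measurable (sphField K Q C) :=
    (lowerSemicontinuous_sphField hK hQ.lowerSemicontinuousOn).measurable
  rw [robinConst, ← heq.2, weightedEnergy_eq hK hQ.lowerSemicontinuousOn hC hC0 heq.1,
    lintegral_sphPotential_add hq]
  set μ := equilibriumMeasure K Q
  have hp : IsProbabilityMeasure μ := heq.1.1
  have hae : ∀ᵐ z ∂μ, z ∈ K := by rw [ae_iff]; exact heq.1.2
  have hA : sphEnergy μ μ ≠ ⊤ := ne_top_of_le_ne_top hfin le_self_add
  have hX : ∫⁻ z, sphField K Q C z ∂μ ≠ ⊤ := by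
    intro h
    simp [fieldEnergy, h] at hfin
  rw [eintegral_eq_of_sub (a := fun z => sphField K Q C z + ENNReal.ofReal (logStretch z))
    (b := fun _ => ENNReal.ofReal C) (hq.add measurable_ofReal_logStretch).aemeasurable
    aemeasurable_const (by rw [lintegral_const, measure_univ, mul_one]; exact ENNReal.ofReal_ne_top)
    (hae.mono fun z hz => coe_sphField_add_logStretch hz (hC z hz) hC0),
    lintegral_add_left hq, lintegral_const, measure_univ, mul_one, EReal.coe_ennreal_ofReal,
    max_eq_left hC0, fieldEnergy, two_mul]
  simp only [EReal.coe_ennreal_add, ← EReal.coe_ennreal_toReal hA, ← EReal.coe_ennreal_toReal hX,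
    ← EReal.coe_ennreal_toReal hL, ENNReal.toReal_add hA hX]
  norm_cast
  ring

theorem lintegral_logStretch_equilibriumMeasure_ne_top (hK : IsClosed K)
    (hQ : WeaklyAdmissible K Q) (hC : ∀ z ∈ K, ((logStretch z - C : ℝ) : EReal) ≤ Q z)
    (hC0 : 0 ≤ C) (hF : ∫⁻ z, (sphPotential (equilibriumMeasure K Q) z + sphField K Q C z)
      ∂(equilibriumMeasure K Q) ≠ ⊤) :
    ∫⁻ z, ENNReal.ofReal (logStretch z) ∂(equilibriumMeasure K Q) ≠ ⊤ := by
  obtain ⟨heq, hfin, hmin⟩ := equilibriumMeasure_spec hK hQ hC hC0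
  have hp : IsProbabilityMeasure (equilibriumMeasure K Q) := heq.1.1
  exact lintegral_logStretch_ne_top hF fun z hz => le_self_add.trans
    (sphPotential_add_le_of_mem_support
      (lowerSemicontinuous_sphField hK hQ.lowerSemicontinuousOn) hfin hmin hz)

end Equilibrium

/-! ### Proof of the theorem -/

theorem weight_eq {K : Set ℂ} {Q : ℂ → EReal} {C : ℝ} {z : ℂ} (hz : sphField K Q C z ≠ ⊤)
    (h : ((logStretch z - C : ℝ) : EReal) ≤ Q z) (hC0 : 0 ≤ C) (k : ℕ) :
    weight Q z ^ k =
      ENNReal.ofReal (Real.exp (k * (C - logStretch z - (sphField K Q C z).toReal))) := by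
  rw [weight, eq_coe_of_sphField_ne_top hz h hC0, ← EReal.coe_neg, EReal.exp_coe,
    ← ENNReal.ofReal_pow (Real.exp_pos _).le, ← Real.exp_nat_mul]
  congr 3
  ring

theorem enorm_mul_ofReal_le_iff {a : ℂ} {x : ℝ} {M : ℝ≥0} :
    ‖a‖ₑ * ENNReal.ofReal x ≤ M ↔ ‖a‖ * x ≤ M := by
  rw [← ofReal_norm, ← ENNReal.ofReal_mul (norm_nonneg a), ← ENNReal.ofReal_coe_nnreal,
    ENNReal.ofReal_le_ofReal_iff M.coe_nonneg]

end

end LogPotential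

open LogPotential in
theorem theorem3p6 (K : Set ℂ) (hK : IsClosed K) (hKpolar : ¬ LogPotential.IsPolar K)
    (Q : ℂ → EReal) (hQ : LogPotential.WeaklyAdmissible K Q)
    (k : ℕ) (p : Polynomial ℂ) (hp : p.degree ≤ k) (M : ℝ≥0)
    (hM : LogPotential.QuasiEverywhereOn (LogPotential.equilibriumSupport K Q)
      (fun z => ‖p.eval z‖ₑ * LogPotential.weight Q z ^ k ≤ M)) :
    (∀ z : ℂ, ‖p.eval z‖ₑ ≤
      M * EReal.exp (k * (-LogPotential.potential (LogPotential.equilibriumMeasure K Q) z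
        + LogPotential.robinConst K Q))) ∧
    LogPotential.QuasiEverywhereOn K
      (fun z => ‖p.eval z‖ₑ * LogPotential.weight Q z ^ k ≤ M) := by
  obtain ⟨C, hC0, hC⟩ := hQ.exists_le hK
  obtain ⟨heq, hfin, hmin⟩ := equilibriumMeasure_spec hK hQ hC hC0
  have hlsc : LowerSemicontinuous (sphField K Q C) :=
    lowerSemicontinuous_sphField hK hQ.lowerSemicontinuousOn
  have hprob : IsProbabilityMeasure (equilibriumMeasure K Q) := heq.1.1
  have hE : sphEnergy (equilibriumMeasure K Q) (equilibriumMeasure K Q) ≠ ⊤ :=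
    ne_top_of_le_ne_top hfin le_self_add
  have hF : ∫⁻ z, (sphPotential (equilibriumMeasure K Q) z + sphField K Q C z)
      ∂(equilibriumMeasure K Q) ≠ ⊤ := by
    rw [lintegral_sphPotential_add hlsc.measurable]
    refine ENNReal.add_ne_top.2 ⟨hE, fun h => ?_⟩
    simp [fieldEnergy, h] at hfin
  have hL := lintegral_logStretch_equilibriumMeasure_ne_top hK hQ hC hC0 hF
  have hrobin := robinConst_eq hK hQ hC hC0 hL
  have hpot := potential_eq hL
  have hpolar := isPolar_setOf_sphPotential_add_lt hlsc.measurable hfin hmin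
  have hsupp := fun z (hz : z ∈ (equilibriumMeasure K Q).support) =>
    sphPotential_add_le_of_mem_support hlsc hfin hmin hz
  obtain ⟨N, hNm, hN, hMN⟩ := hM
  unfold equilibriumSupport at hMN
  have hNnull := hN.measure_eq_zero hNm hE
  have hSN : ∀ᵐ z ∂(equilibriumMeasure K Q), z ∈ (equilibriumMeasure K Q).support \ N := by
    filter_upwards [Measure.support_mem_ae, compl_mem_ae_iff.2 hNnull] with z h1 h2 using ⟨h1, h2⟩
  have hm : Measurable fun z => sphPotential (equilibriumMeasure K Q) z + sphField K Q C z :=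
    (measurable_sphPotential _).add hlsc.measurable
  set μ := equilibriumMeasure K Q
  set F := ∫⁻ z, (sphPotential μ z + sphField K Q C z) ∂μ
  set l := (∫⁻ z, ENNReal.ofReal (logStretch z) ∂μ).toReal
  have hnat : p.natDegree ≤ k := Polynomial.natDegree_le_of_degree_le hp
  -- On the support G + q ≤ F, so G - ½ log(1 + |z|²) is at most -Q + F - C.
  have hae : ∀ᵐ z ∂μ, sphPotential μ z ≠ ⊤ ∧
      ‖p.eval z‖ * Real.exp (k * ((sphPotential μ z).toReal - logStretch z)) ≤
        M * Real.exp (k * (F.toReal - C)) := by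
    filter_upwards [hSN] with z hz
    have hle := hsupp z hz.1
    have hfin' := ne_top_of_le_ne_top hF hle
    obtain ⟨hG, hq⟩ := ENNReal.add_ne_top.1 hfin'
    refine ⟨hG, ?_⟩
    have h1 : ‖p.eval z‖ₑ * weight Q z ^ k ≤ M := hMN z hz
    rw [weight_eq hq (hC z (mem_of_sphField_ne_top hq)) hC0,
      enorm_mul_ofReal_le_iff] at h1
    have h2 := ENNReal.toReal_mono hF hle
    rw [ENNReal.toReal_add hG hq] at h2
    calc _ ≤ ‖p.eval z‖ * Real.exp (k * (C - logStretch z - (sphField K Q C z).toReal) +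
          k * (F.toReal - C)) := by
          rw [← mul_add]
          gcongr
          linarith
      _ = (‖p.eval z‖ * Real.exp (k * (C - logStretch z - (sphField K Q C z).toReal))) *
          Real.exp (k * (F.toReal - C)) := by rw [Real.exp_add, mul_assoc]
      _ ≤ _ := by gcongr
  -- Here p is constant and the weight is 1, so one point of the support outside N decides
  -- everything.
  have hconst : k = 0 → ∀ z, ‖p.eval z‖ₑ ≤ M := by
    rintro rfl z
    have hpC := Polynomial.eq_C_of_degree_le_zero (by simpa using hp)
    obtain ⟨y, hy⟩ := hSN.exists
    have := hMN y hy
    rw [hpC] at this ⊢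
    simpa using this
  have hbound : ∀ z, k ≠ 0 → sphPotential μ z ≠ ⊤ →
      ‖p.eval z‖ * Real.exp (k * ((sphPotential μ z).toReal - logStretch z)) ≤
        M * Real.exp (k * (F.toReal - C)) := fun z hk hz =>
    norm_eval_mul_exp_sphPotential_le_of_ae hE hk hnat hae hz
  have hzero : ∀ z, k ≠ 0 → sphPotential μ z = ⊤ → p.eval z = 0 := fun z hk hz =>
    eval_eq_zero_of_ae hE hk hnat hae hz
  -- The exceptional set is where the lower Frostman inequality fails; it depends neither on p nor
  -- on N.
  refine ⟨fun z => ?_, {z | sphPotential μ z + sphField K Q C z < F},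
    measurableSet_lt hm measurable_const, hpolar, fun z hz => ?_⟩
  · by_cases hk : k = 0
    · simpa [hk] using hconst hk z
    -- At such a point the right-hand side is 0, so the vanishing of p there is really needed.
    by_cases hz : sphPotential μ z = ⊤
    · simp [hzero z hk hz]
    -- The logarithmic moment occurs in both terms and cancels.
    have hexp : -potential μ z + robinConst K Q =
        ((logStretch z - (sphPotential μ z).toReal + F.toReal - C : ℝ) : EReal) := by
      rw [hpot, hrobin, ← EReal.coe_ennreal_toReal hz]
      norm_cast
      ring
    rw [hexp, ← EReal.coe_natCast, ← EReal.coe_mul, EReal.exp_coe, ← ENNReal.ofReal_coe_nnreal,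
      ← ENNReal.ofReal_mul M.coe_nonneg, ← ofReal_norm]
    refine ENNReal.ofReal_le_ofReal ?_
    have h1 := hbound z hk hz
    rw [← le_div_iff₀ (Real.exp_pos _), mul_div_assoc, ← Real.exp_sub] at h1
    refine h1.trans_eq ?_
    congr 2
    ring
  · by_cases hk : k = 0
    · simpa [hk] using hconst hk z
    by_cases hq : sphField K Q C z = ⊤
    · simp [weight, sphField_eq_top hz.1 hq, hk]
    by_cases hG : sphPotential μ z = ⊤
    · simp [hzero z hk hG]
    change ‖p.eval z‖ₑ * weight Q z ^ k ≤ M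
    rw [weight_eq hq (hC z hz.1) hC0, enorm_mul_ofReal_le_iff]
    have h1 := hbound z hk hG
    have h2 : F.toReal ≤ (sphPotential μ z).toReal + (sphField K Q C z).toReal := by
      rw [← ENNReal.toReal_add hG hq]
      exact ENNReal.toReal_mono (ENNReal.add_ne_top.2 ⟨hG, hq⟩) (not_lt.1 hz.2)
    calc _ ≤ ‖p.eval z‖ * Real.exp (k * ((sphPotential μ z).toReal - logStretch z) +
          -(k * (F.toReal - C))) := by
          rw [← mul_neg, ← mul_add]
          gcongr
          linarith
      _ = (‖p.eval z‖ * Real.exp (k * ((sphPotential μ z).toReal - logStretch z))) *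
          Real.exp (-(k * (F.toReal - C))) := by rw [Real.exp_add, mul_assoc]
      _ ≤ (M * Real.exp (k * (F.toReal - C))) * Real.exp (-(k * (F.toReal - C))) := by gcongr
      _ = M := by rw [mul_assoc, ← Real.exp_add, add_neg_cancel, Real.exp_zero, mul_one]
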